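/- Let $q$ be a nonzero complex number that is not a root of unity, and fix a square root $q^{1/2}$ of $q$ (so $q^{j+1/2}=q^jq^{1/2}$ for $j\in\mathbf Z$). Let $U_q(\mathrm{iso}_2)$ be the complex associative unital algebra generated by $I,T_1,T_2$ with the defining relations $$q^{1/2}IT_2-q^{-1/2}T_2I=T_1,\qquad q^{1/2}T_1I-q^{-1/2}IT_1=T_2,\qquad q^{1/2}T_2T_1-q^{-1/2}T_1T_2=0 .$$ A representation $\pi$ on a complex Hilbert space $\mathcal H$ is a homomorphism of $U_q(\mathrm{iso}_2)$ into the algebra of linear operators (bounded or unbounded) on $\mathcal H$ defined on a dense invariant subspace $\mathcal D\subset\mathcal H$, such that $\pi(I)$ can be diagonalized: the eigenvectors of $\pi(I)$ lying in $\mathcal D$ span a dense subspace of $\mathcal H$, and $\pi(I)$ has no Jordan blocks of size $\ge 2$, i.e. $(\pi(I)-\mu)^2v=0$ implies $(\pi(I)-\mu)v=0$ for $\mu\in\mathbf C$, $v\in\mathcal D$. It is irreducible if $\mathcal D\ne 0$ and $\mathcal D$ has no invariant subspaces other than $0$ and $\mathcal D$; for irreducible representations the eigenvalues of $\pi(I)$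 are required to have finite multiplicities. Representations $\pi$ on $\mathcal H$ and $\pi'$ on $\mathcal H'$ are equivalent if there are invariant subspaces $V$, $V'$ of their domains, dense in $\mathcal H$ and $\mathcal H'$ respectively, and a linear bijection $A:V\to V'$ with $A\pi(a)v=\pi'(a)Av$ for all $a\in U_q(\mathrm{iso}_2)$ and $v\in V$. Theorem. Every irreducible representation $\pi$ of $U_q(\mathrm{iso}_2)$ is one-dimensional ($\dim\mathcal H=1$) or is equivalent to one of the following representations, each having as its domain the linear span of the given orthonormal basis of the Hilbert space on which it acts. (i) The classical type representations $R_{rs}$, where $r,s\in\mathbf C\setminus\{0\}$ and $s\ne\pm\mathrm i q^{n}$, $s\ne\pm\mathrm i q^{n+1/2}$ for all $n\in\mathbf Z$, with basis $|m\rangle$, $m\in\mathbf Z$: $$R_{rs}(I)|m\rangle=\mathrm i\,\frac{sq^m-s^{-1}q^{-m}}{q-q^{-1}}|m\rangle,\qquad R_{rs}(T_2)|m\rangle=\frac{r}{sq^m+s^{-1}q^{-m}}\bigl(|m+1\rangle+|m-1\rangle\bigr),$$ $$R_{rs}(T_1)|m\rangle=\frac{\mathrm i q^{1/2}r}{sq^m+s^{-1}q^{-m}}\bigl(sq^m|m+1\rangle-s^{-1}q^{-m}|m-1\rangle\bigr).$$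 (ii) The non-classical type representations $R_r^{\varepsilon,\tilde\varepsilon}$, where $r\in\mathbf C\setminus\{0\}$ and $\varepsilon,\tilde\varepsilon\in\{1,-1\}$, with basis $|j\rangle$, $j=0,1,2,\dots$: $$R_r^{\varepsilon,\tilde\varepsilon}(I)|j\rangle=-\varepsilon\,\frac{q^{j+1/2}+q^{-j-1/2}}{q-q^{-1}}|j\rangle\quad (j\ge 0),$$ $$R_r^{\varepsilon,\tilde\varepsilon}(T_2)|0\rangle=-\frac{\varepsilon r}{q^{1/2}-q^{-1/2}}\bigl(\tilde\varepsilon|0\rangle+\mathrm i|1\rangle\bigr),\qquad R_r^{\varepsilon,\tilde\varepsilon}(T_2)|j\rangle=-\frac{\varepsilon\,\mathrm i r}{q^{j+1/2}-q^{-j-1/2}}\bigl(|j+1\rangle+|j-1\rangle\bigr)\quad(j\ge1),$$ $$R_r^{\varepsilon,\tilde\varepsilon}(T_1)|0\rangle=\frac{r}{q^{1/2}-q^{-1/2}}\bigl(\tilde\varepsilon|0\rangle+\mathrm i q|1\rangle\bigr),\qquad R_r^{\varepsilon,\tilde\varepsilon}(T_1)|j\rangle=\frac{\mathrm i r}{q^{j+1/2}-q^{-j-1/2}}\bigl(q^{j+1}|j+1\rangle+q^{-j}|j-1\rangle\bigr)\quad(j\ge1).$$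 That is, up to equivalence these families together with the one-dimensional representations exhaust all irreducible representations of $U_q(\mathrm{iso}_2)$. -/

import Mathlib

/-!  The parameter `p` below is a fixed square root `q^{1/2}` of `q`; thus `q = p ^ 2`. -/

/-- The three generators. -/
inductive IsoGen : Type
  | I
  | T1
  | T2

/-- The defining relations: `[I,T₂]_q = T₁`, `[T₁,I]_q = T₂`, `[T₂,T₁]_q = 0`, where
`[A,B]_q = q^{1/2} A B - q^{-1/2} B A`. -/
inductive IsoRel (p : ℂ) : FreeAlgebra ℂ IsoGen → FreeAlgebra ℂ IsoGen → Prop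
  | rel1 : IsoRel p
      (p • (FreeAlgebra.ι ℂ IsoGen.I * FreeAlgebra.ι ℂ IsoGen.T2)
        - p⁻¹ • (FreeAlgebra.ι ℂ IsoGen.T2 * FreeAlgebra.ι ℂ IsoGen.I))
      (FreeAlgebra.ι ℂ IsoGen.T1)
  | rel2 : IsoRel p
      (p • (FreeAlgebra.ι ℂ IsoGen.T1 * FreeAlgebra.ι ℂ IsoGen.I)
        - p⁻¹ • (FreeAlgebra.ι ℂ IsoGen.I * FreeAlgebra.ι ℂ IsoGen.T1))
      (FreeAlgebra.ι ℂ IsoGen.T2)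
  | rel3 : IsoRel p
      (p • (FreeAlgebra.ι ℂ IsoGen.T2 * FreeAlgebra.ι ℂ IsoGen.T1)
        - p⁻¹ • (FreeAlgebra.ι ℂ IsoGen.T1 * FreeAlgebra.ι ℂ IsoGen.T2))
      0

/-- The complex associative unital algebra `U_q(iso₂)`, with `q = p ^ 2`. -/
abbrev UqIso (p : ℂ) : Type := RingQuot (IsoRel p)

namespace UqIso

/-- The generators as elements of `U_q(iso₂)`. -/
noncomputable def gen (p : ℂ) (x : IsoGen) : UqIso p :=
  RingQuot.mkAlgHom ℂ (IsoRel p) (FreeAlgebra.ι ℂ x)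

/-- The homomorphism out of `U_q(iso₂)` determined by three elements that satisfy the defining
relations. -/
noncomputable def lift (p : ℂ) {A : Type*} [Ring A] [Algebra ℂ A] (i t1 t2 : A)
    (h1 : p • (i * t2) - p⁻¹ • (t2 * i) = t1)
    (h2 : p • (t1 * i) - p⁻¹ • (i * t1) = t2)
    (h3 : p • (t2 * t1) - p⁻¹ • (t1 * t2) = 0) : UqIso p →ₐ[ℂ] A :=
  RingQuot.liftAlgHom ℂ (s := IsoRel p)
    ⟨FreeAlgebra.lift ℂ (fun x : IsoGen => match x with
      | IsoGen.I => i
      | IsoGen.T1 => t1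
      | IsoGen.T2 => t2), by
      intro a b hab
      cases hab with
      | rel1 => simpa using h1
      | rel2 => simpa using h2
      | rel3 => simpa using h3⟩

end UqIso

/-- A homomorphism of `U_q(iso₂)` into the algebra of linear operators (bounded or unbounded) on
`H` that are defined on a common dense invariant subspace `domain`. -/
structure OperatorRep (p : ℂ) (H : Type*) [NormedAddCommGroup H] [InnerProductSpace ℂ H] where
  domain : Submodule ℂ H
  dense_domain : Dense (domain : Set H)
  hom : UqIso p →ₐ[ℂ] Module.End ℂ domain

namespace OperatorRep

variable {p : ℂ} {H : Type*} [NormedAddCommGroup H] [InnerProductSpace ℂ H]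
  {H' : Type*} [NormedAddCommGroup H'] [InnerProductSpace ℂ H']

/-- The operator `π(I)`. -/
noncomputable def opI (π : OperatorRep p H) : Module.End ℂ π.domain :=
  π.hom (UqIso.gen p IsoGen.I)

/-- `π(I)` can be diagonalized: its eigenvectors in the domain span a dense subspace of `H`, and
it has no Jordan blocks of size two or more. Every operator that acts diagonally
with respect to a basis consisting of eigenvectors has these two properties. -/
structure IsDiagonalizable (π : OperatorRep p H) : Prop where
  dense_span_eigenvectors :
    Dense (Submodule.span ℂ {x : H | ∃ (μ : ℂ) (v : π.domain), π.opI v = μ • v ∧ (v : H) = x} :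
      Set H)
  no_jordan_block : ∀ (μ : ℂ) (v : π.domain),
    π.opI (π.opI v - μ • v) = μ • (π.opI v - μ • v) → π.opI v = μ • v

/-- The eigenvalues of `π(I)` have finite multiplicities. -/
def HasFiniteMultiplicities (π : OperatorRep p H) : Prop :=
  ∀ μ : ℂ, FiniteDimensional ℂ (Module.End.eigenspace π.opI μ)

/-- A subspace of the domain that is mapped into itself by all operators `π(a)`. -/
def IsInvariant (π : OperatorRep p H) (V : Submodule ℂ π.domain) : Prop :=
  ∀ a : UqIso p, ∀ v ∈ V, π.hom a v ∈ V

/-- Irreducibility: the domain is nonzero and has no invariant subspaces but zero and itself. -/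
structure IsIrreducible (π : OperatorRep p H) : Prop where
  nontrivial : Nontrivial π.domain
  eq_bot_or_eq_top : ∀ V : Submodule ℂ π.domain, π.IsInvariant V → V = ⊥ ∨ V = ⊤

/-- (Algebraic) equivalence: `A π(a) v = π'(a) A v` on `V`, for a linear bijection `A : V → V'`
between dense invariant subspaces of the two Hilbert spaces. -/
def IsEquivalent (π : OperatorRep p H) (π' : OperatorRep p H') : Prop :=
  ∃ (V : Submodule ℂ π.domain) (V' : Submodule ℂ π'.domain)
    (hV : π.IsInvariant V) (hV' : π'.IsInvariant V'),
    Dense (V.map π.domain.subtype : Set H) ∧ Dense (V'.map π'.domain.subtype : Set H') ∧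
    ∃ A : V ≃ₗ[ℂ] V', ∀ (a : UqIso p) (v : V),
      A ⟨π.hom a v, hV a v v.2⟩ = ⟨π'.hom a (A v), hV' a (A v) (A v).2⟩

end OperatorRep

/-- The standard orthonormal basis of `ℓ²(ι)`. -/
noncomputable def l2Basis (ι : Type*) : HilbertBasis ι ℂ (lp (fun _ : ι => ℂ) 2) :=
  HilbertBasis.ofRepr (LinearIsometryEquiv.refl ℂ _)

/-- The representation on `ℓ²(ι)`, with domain the linear span of the standard basis `|m⟩`,
`m : ι`, that is given in coordinates (`|m⟩` being `Finsupp.single m 1`) by `φ`. -/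
noncomputable def OperatorRep.ofCoordinates {p : ℂ} {ι : Type*}
    (φ : UqIso p →ₐ[ℂ] Module.End ℂ (ι →₀ ℂ)) :
    OperatorRep p (lp (fun _ : ι => ℂ) 2) where
  domain := Submodule.span ℂ (Set.range (l2Basis ι))
  dense_domain := by
    rw [Submodule.dense_iff_topologicalClosure_eq_top]
    exact (l2Basis ι).dense_span
  hom := (LinearEquiv.conjAlgEquiv ℂ
    (l2Basis ι).orthonormal.linearIndependent.linearCombinationEquiv).toAlgHom.comp φ

/-- The linear operator on the space with basis `|m⟩`, `m : ι`, that sends `|m⟩` to `f m`. -/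
noncomputable def opOfBasis {ι : Type*} (f : ι → ι →₀ ℂ) : Module.End ℂ (ι →₀ ℂ) :=
  Finsupp.linearCombination ℂ f

theorem opOfBasis_single {ι : Type*} (f : ι → ι →₀ ℂ) (m : ι) (c : ℂ) :
    opOfBasis f (Finsupp.single m c) = c • f m := by
  simp [opOfBasis, Finsupp.linearCombination_single]

/-- `I |m⟩ = i (s q^m - s⁻¹ q^{-m}) / (q - q⁻¹) |m⟩`, `m ∈ ℤ`. -/
noncomputable def classicalI (p s : ℂ) : Module.End ℂ (ℤ →₀ ℂ) :=
  opOfBasis fun m => (Complex.I * (s * (p ^ 2) ^ m - s⁻¹ * (p ^ 2) ^ (-m)) /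
    (p ^ 2 - (p ^ 2)⁻¹)) • Finsupp.single m 1

/-- `T₂ |m⟩ = r / (s q^m + s⁻¹ q^{-m}) (|m+1⟩ + |m-1⟩)`, `m ∈ ℤ`. -/
noncomputable def classicalT2 (p r s : ℂ) : Module.End ℂ (ℤ →₀ ℂ) :=
  opOfBasis fun m => (r / (s * (p ^ 2) ^ m + s⁻¹ * (p ^ 2) ^ (-m))) •
    (Finsupp.single (m + 1) 1 + Finsupp.single (m - 1) 1)

/-- `T₁ |m⟩ = i q^{1/2} r / (s q^m + s⁻¹ q^{-m}) (s q^m |m+1⟩ - s⁻¹ q^{-m} |m-1⟩)`, `m ∈ ℤ`. -/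
noncomputable def classicalT1 (p r s : ℂ) : Module.End ℂ (ℤ →₀ ℂ) :=
  opOfBasis fun m => (Complex.I * p * r / (s * (p ^ 2) ^ m + s⁻¹ * (p ^ 2) ^ (-m))) •
    ((s * (p ^ 2) ^ m) • Finsupp.single (m + 1) 1
      - (s⁻¹ * (p ^ 2) ^ (-m)) • Finsupp.single (m - 1) 1)

theorem classical_den_ne {p s : ℂ} (hp : p ≠ 0) (hs : s ≠ 0)
    (hs' : ∀ n : ℤ, s ≠ Complex.I * (p ^ 2) ^ n ∧ s ≠ -(Complex.I * (p ^ 2) ^ n)) (m : ℤ) :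
    s * (p ^ 2) ^ m + s⁻¹ * (p ^ 2) ^ (-m) ≠ 0 := by
  intro h
  have hq : (p ^ 2) ≠ 0 := pow_ne_zero 2 hp
  have hu : (p ^ 2) ^ m ≠ 0 := zpow_ne_zero m hq
  rw [zpow_neg] at h
  have h1 : (s - Complex.I * (p ^ 2) ^ (-m)) * (s + Complex.I * (p ^ 2) ^ (-m)) = 0 := by
    rw [zpow_neg]
    generalize (p ^ 2) ^ m = u at *
    field_simp at h ⊢
    linear_combination h - Complex.I_sq
  rcases mul_eq_zero.1 h1 with h2 | h2
  · exact (hs' (-m)).1 (sub_eq_zero.1 h2)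
  · exact (hs' (-m)).2 (eq_neg_of_add_eq_zero_left h2)

theorem q_sub_inv_ne {p : ℂ} (hp : p ≠ 0) (hq : ∀ n : ℕ, 0 < n → (p ^ 2) ^ n ≠ 1) :
    p ^ 2 - (p ^ 2)⁻¹ ≠ 0 := by
  intro h
  apply hq 2 (by norm_num)
  have : p ^ 2 ≠ 0 := pow_ne_zero 2 hp
  generalize p ^ 2 = x at *
  field_simp at h
  linear_combination h

theorem classical_rel1 {p r s : ℂ} (hp : p ≠ 0) (hq : ∀ n : ℕ, 0 < n → (p ^ 2) ^ n ≠ 1)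
    (hs : s ≠ 0) :
    p • (classicalI p s * classicalT2 p r s) - p⁻¹ • (classicalT2 p r s * classicalI p s)
      = classicalT1 p r s := by
  have hQ := q_sub_inv_ne hp hq
  have hq0 : (p ^ 2) ≠ 0 := pow_ne_zero 2 hp
  refine Finsupp.lhom_ext fun m c => ?_
  simp only [classicalI, classicalT2, classicalT1, LinearMap.sub_apply, LinearMap.smul_apply,
    Module.End.mul_apply, opOfBasis_single, map_smul, map_add, one_smul]
  have hu : (p ^ 2) ^ m ≠ 0 := zpow_ne_zero m hq0
  simp only [neg_add, neg_sub, zpow_add₀ hq0, zpow_sub₀ hq0, zpow_neg, zpow_one, sub_eq_add_neg 1 m]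
  generalize (p ^ 2) ^ m = u at *
  generalize s * u + s⁻¹ * u⁻¹ = d
  generalize hQd : p ^ 2 - (p ^ 2)⁻¹ = Q at *
  match_scalars
  all_goals
    field_simp at hQd ⊢
    try grind

theorem classical_rel2 {p r s : ℂ} (hp : p ≠ 0) (hq : ∀ n : ℕ, 0 < n → (p ^ 2) ^ n ≠ 1)
    (hs : s ≠ 0)
    (hs' : ∀ n : ℤ, s ≠ Complex.I * (p ^ 2) ^ n ∧ s ≠ -(Complex.I * (p ^ 2) ^ n)) :
    p • (classicalT1 p r s * classicalI p s) - p⁻¹ • (classicalI p s * classicalT1 p r s)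
      = classicalT2 p r s := by
  have hQ := q_sub_inv_ne hp hq
  have hq0 : (p ^ 2) ≠ 0 := pow_ne_zero 2 hp
  refine Finsupp.lhom_ext fun m c => ?_
  have hd := classical_den_ne hp hs hs' m
  simp only [classicalI, classicalT2, classicalT1, LinearMap.sub_apply, LinearMap.smul_apply,
    Module.End.mul_apply, opOfBasis_single, map_smul, map_sub, one_smul]
  have hu : (p ^ 2) ^ m ≠ 0 := zpow_ne_zero m hq0
  simp only [neg_add, neg_sub, zpow_add₀ hq0, zpow_sub₀ hq0, zpow_neg, zpow_one] at hd ⊢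
  generalize (p ^ 2) ^ m = u at *
  generalize hdd : s * u + s⁻¹ * u⁻¹ = d at *
  generalize hQd : p ^ 2 - (p ^ 2)⁻¹ = Q at *
  have hI := Complex.I_sq
  match_scalars
  all_goals
    field_simp at hQd hdd ⊢
    try grind

theorem classical_rel3 {p r s : ℂ} (hp : p ≠ 0)
    (hs : s ≠ 0)
    (hs' : ∀ n : ℤ, s ≠ Complex.I * (p ^ 2) ^ n ∧ s ≠ -(Complex.I * (p ^ 2) ^ n)) :
    p • (classicalT2 p r s * classicalT1 p r s) - p⁻¹ • (classicalT1 p r s * classicalT2 p r s)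
      = 0 := by
  have hq0 : (p ^ 2) ≠ 0 := pow_ne_zero 2 hp
  refine Finsupp.lhom_ext fun m c => ?_
  have hd := classical_den_ne hp hs hs' m
  have hd1 := classical_den_ne hp hs hs' (m + 1)
  have hd2 := classical_den_ne hp hs hs' (m - 1)
  simp only [classicalT2, classicalT1, LinearMap.sub_apply, LinearMap.smul_apply,
    Module.End.mul_apply, opOfBasis_single, map_smul, map_add, map_sub, one_smul,
    LinearMap.zero_apply, add_sub_cancel_right, sub_add_cancel]
  have hu : (p ^ 2) ^ m ≠ 0 := zpow_ne_zero m hq0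
  simp only [neg_add, neg_sub, zpow_add₀ hq0, zpow_sub₀ hq0, zpow_neg, zpow_one] at hd hd1 hd2 ⊢
  generalize (p ^ 2) ^ m = u at *
  generalize hdd : s * u + s⁻¹ * u⁻¹ = d at *
  generalize hdd1 : s * (u * p ^ 2) + s⁻¹ * (u⁻¹ * (p ^ 2)⁻¹) = d1 at *
  generalize hdd2 : s * (u / p ^ 2) + s⁻¹ * (p ^ 2 / u) = d2 at *
  match_scalars
  all_goals
    field_simp at hdd hdd1 hdd2 ⊢
    first
      | grind
      | linear_combination c * Complex.I * r ^ 2 * (d2 * hdd1 - d1 * hdd2)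

/-- The representation `R_{rs}` on `ℓ²(ℤ)`, whose domain is the span of the basis vectors. -/
noncomputable def classicalRep (p r s : ℂ) (hp : p ≠ 0)
    (hq : ∀ n : ℕ, 0 < n → (p ^ 2) ^ n ≠ 1) (hs : s ≠ 0)
    (hs' : ∀ n : ℤ, s ≠ Complex.I * (p ^ 2) ^ n ∧ s ≠ -(Complex.I * (p ^ 2) ^ n)) :
    OperatorRep p (lp (fun _ : ℤ => ℂ) 2) :=
  OperatorRep.ofCoordinates
    (UqIso.lift p (classicalI p s) (classicalT1 p r s) (classicalT2 p r s)
      (classical_rel1 hp hq hs) (classical_rel2 hp hq hs hs') (classical_rel3 hp hs hs'))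

/-- `I |j⟩ = -ε (q^{j+1/2} + q^{-j-1/2}) / (q - q⁻¹) |j⟩`, `j = 0, 1, 2, …`. -/
noncomputable def nonclassicalI (p : ℂ) (ε : ℤˣ) : Module.End ℂ (ℕ →₀ ℂ) :=
  opOfBasis fun j => (-((ε : ℤ) : ℂ) * (p ^ (2 * j + 1) + (p ^ (2 * j + 1))⁻¹) /
    (p ^ 2 - (p ^ 2)⁻¹)) • Finsupp.single j 1

/-- `T₂ |0⟩ = -ε r / (q^{1/2} - q^{-1/2}) (ε' |0⟩ + i |1⟩)` and
`T₂ |j⟩ = -ε i r / (q^{j+1/2} - q^{-j-1/2}) (|j+1⟩ + |j-1⟩)` for `j = 1, 2, …`. -/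
noncomputable def nonclassicalT2 (p r : ℂ) (ε ε' : ℤˣ) : Module.End ℂ (ℕ →₀ ℂ) :=
  opOfBasis fun j => match j with
    | 0 => (-((ε : ℤ) : ℂ) * r / (p - p⁻¹)) •
        (((ε' : ℤ) : ℂ) • Finsupp.single 0 1 + Complex.I • Finsupp.single 1 1)
    | k + 1 => (-((ε : ℤ) : ℂ) * Complex.I * r /
          (p ^ (2 * (k + 1) + 1) - (p ^ (2 * (k + 1) + 1))⁻¹)) •
        (Finsupp.single (k + 2) 1 + Finsupp.single k 1)

/-- `T₁ |0⟩ = r / (q^{1/2} - q^{-1/2}) (ε' |0⟩ + i q |1⟩)` and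
`T₁ |j⟩ = i r / (q^{j+1/2} - q^{-j-1/2}) (q^{j+1} |j+1⟩ + q^{-j} |j-1⟩)` for `j = 1, 2, …`. -/
noncomputable def nonclassicalT1 (p r : ℂ) (ε' : ℤˣ) : Module.End ℂ (ℕ →₀ ℂ) :=
  opOfBasis fun j => match j with
    | 0 => (r / (p - p⁻¹)) •
        (((ε' : ℤ) : ℂ) • Finsupp.single 0 1 + (Complex.I * p ^ 2) • Finsupp.single 1 1)
    | k + 1 => (Complex.I * r / (p ^ (2 * (k + 1) + 1) - (p ^ (2 * (k + 1) + 1))⁻¹)) •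
        ((p ^ 2) ^ (k + 2) • Finsupp.single (k + 2) 1
          + ((p ^ 2) ^ (k + 1))⁻¹ • Finsupp.single k 1)

theorem nonclassical_den_ne {p : ℂ} (hp : p ≠ 0) (hq : ∀ n : ℕ, 0 < n → (p ^ 2) ^ n ≠ 1)
    (j : ℕ) : p ^ (2 * j + 1) - (p ^ (2 * j + 1))⁻¹ ≠ 0 := by
  intro h
  apply hq (2 * j + 1) (by omega)
  have hx : p ^ (2 * j + 1) ≠ 0 := pow_ne_zero _ hp
  rw [← pow_mul, mul_comm, pow_mul]
  generalize p ^ (2 * j + 1) = x at *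
  field_simp at h
  linear_combination h

theorem nonclassical_rel1 {p r : ℂ} (hp : p ≠ 0) (hq : ∀ n : ℕ, 0 < n → (p ^ 2) ^ n ≠ 1)
    (ε ε' : ℤˣ) :
    p • (nonclassicalI p ε * nonclassicalT2 p r ε ε')
      - p⁻¹ • (nonclassicalT2 p r ε ε' * nonclassicalI p ε) = nonclassicalT1 p r ε' := by
  have hQ := q_sub_inv_ne hp hq
  have hI := Complex.I_sq
  have hε : ((ε : ℤ) : ℂ) ^ 2 = 1 := by rcases Int.units_eq_one_or ε with h | h <;> simp [h]
  have hε' : ((ε' : ℤ) : ℂ) ^ 2 = 1 := by rcases Int.units_eq_one_or ε' with h | h <;> simp [h]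
  generalize hQd : p ^ 2 - (p ^ 2)⁻¹ = Q at *
  refine Finsupp.lhom_ext fun m c => ?_
  rcases m with _ | k
  · have hd := nonclassical_den_ne hp hq 0
    simp only [nonclassicalI, nonclassicalT2, nonclassicalT1, LinearMap.sub_apply,
      LinearMap.smul_apply, Module.End.mul_apply, opOfBasis_single, map_smul, map_add, one_smul,
      mul_zero, zero_add, pow_one, hQd, mul_one] at hd ⊢
    generalize hdd : p - p⁻¹ = d at *
    generalize ((ε : ℤ) : ℂ) = e at *
    generalize ((ε' : ℤ) : ℂ) = e' at *
    match_scalars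
    all_goals
      field_simp at hQd hdd ⊢
      try grind
  · have hd := nonclassical_den_ne hp hq (k + 1)
    have hx : p ^ (2 * k + 1) ≠ 0 := pow_ne_zero _ hp
    simp only [nonclassicalI, nonclassicalT2, nonclassicalT1, LinearMap.sub_apply,
      LinearMap.smul_apply, Module.End.mul_apply, opOfBasis_single, map_smul, map_add, one_smul,
      hQd] at hd ⊢
    have e1 : p ^ (2 * (k + 1) + 1) = p ^ (2 * k + 1) * p ^ 2 := by ring
    have e2 : p ^ (2 * (k + 2) + 1) = p ^ (2 * k + 1) * p ^ 4 := by ring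
    have e3 : (p ^ 2) ^ (k + 1) = p ^ (2 * k + 1) * p := by ring
    have e4 : (p ^ 2) ^ (k + 2) = p ^ (2 * k + 1) * p ^ 3 := by ring
    simp only [e1, e2, e3, e4] at hd ⊢
    generalize p ^ (2 * k + 1) = x at *
    generalize hdd : x * p ^ 2 - (x * p ^ 2)⁻¹ = d at *
    generalize ((ε : ℤ) : ℂ) = e at *
    match_scalars
    all_goals
      field_simp at hQd hdd ⊢
      first
        | grind
        | linear_combination c * r * p ^ 4 * x ^ 2 * (p ^ 4 - 1) * hε
          + c * r * p ^ 4 * x ^ 2 * hQd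
        | linear_combination c * r * (p ^ 4 - 1) * hε + c * r * hQd

theorem nonclassical_rel2 {p r : ℂ} (hp : p ≠ 0) (hq : ∀ n : ℕ, 0 < n → (p ^ 2) ^ n ≠ 1)
    (ε ε' : ℤˣ) :
    p • (nonclassicalT1 p r ε' * nonclassicalI p ε)
      - p⁻¹ • (nonclassicalI p ε * nonclassicalT1 p r ε') = nonclassicalT2 p r ε ε' := by
  have hQ := q_sub_inv_ne hp hq
  have hI := Complex.I_sq
  have hε : ((ε : ℤ) : ℂ) ^ 2 = 1 := by rcases Int.units_eq_one_or ε with h | h <;> simp [h]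
  have hε' : ((ε' : ℤ) : ℂ) ^ 2 = 1 := by rcases Int.units_eq_one_or ε' with h | h <;> simp [h]
  generalize hQd : p ^ 2 - (p ^ 2)⁻¹ = Q at *
  refine Finsupp.lhom_ext fun m c => ?_
  rcases m with _ | k
  · have hd := nonclassical_den_ne hp hq 0
    simp only [nonclassicalI, nonclassicalT2, nonclassicalT1, LinearMap.sub_apply,
      LinearMap.smul_apply, Module.End.mul_apply, opOfBasis_single, map_smul, map_add, one_smul,
      mul_zero, zero_add, pow_one, hQd, mul_one] at hd ⊢
    generalize hdd : p - p⁻¹ = d at *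
    generalize ((ε : ℤ) : ℂ) = e at *
    generalize ((ε' : ℤ) : ℂ) = e' at *
    match_scalars
    all_goals
      field_simp at hQd hdd ⊢
      try grind
  · have hd := nonclassical_den_ne hp hq (k + 1)
    have hx : p ^ (2 * k + 1) ≠ 0 := pow_ne_zero _ hp
    simp only [nonclassicalI, nonclassicalT2, nonclassicalT1, LinearMap.sub_apply,
      LinearMap.smul_apply, Module.End.mul_apply, opOfBasis_single, map_smul, map_add, one_smul,
      hQd] at hd ⊢
    have e1 : p ^ (2 * (k + 1) + 1) = p ^ (2 * k + 1) * p ^ 2 := by ring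
    have e2 : p ^ (2 * (k + 2) + 1) = p ^ (2 * k + 1) * p ^ 4 := by ring
    have e3 : (p ^ 2) ^ (k + 1) = p ^ (2 * k + 1) * p := by ring
    have e4 : (p ^ 2) ^ (k + 2) = p ^ (2 * k + 1) * p ^ 3 := by ring
    simp only [e1, e2, e3, e4] at hd ⊢
    generalize p ^ (2 * k + 1) = x at *
    generalize hdd : x * p ^ 2 - (x * p ^ 2)⁻¹ = d at *
    generalize ((ε : ℤ) : ℂ) = e at *
    match_scalars
    all_goals
      field_simp at hQd hdd ⊢
      first
        | grind
        | linear_combination (-c * e * r) * hQd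
        | linear_combination (-c * e * r * x ^ 2) * hQd

theorem nonclassical_rel3 {p r : ℂ} (hp : p ≠ 0) (hq : ∀ n : ℕ, 0 < n → (p ^ 2) ^ n ≠ 1)
    (ε ε' : ℤˣ) :
    p • (nonclassicalT2 p r ε ε' * nonclassicalT1 p r ε')
      - p⁻¹ • (nonclassicalT1 p r ε' * nonclassicalT2 p r ε ε') = 0 := by
  have hI := Complex.I_sq
  have hε' : ((ε' : ℤ) : ℂ) ^ 2 = 1 := by rcases Int.units_eq_one_or ε' with h | h <;> simp [h]
  refine Finsupp.lhom_ext fun m c => ?_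
  rcases m with _ | _ | k
  · have hd := nonclassical_den_ne hp hq 0
    have hd1 := nonclassical_den_ne hp hq 1
    simp only [nonclassicalT2, nonclassicalT1, LinearMap.sub_apply, LinearMap.zero_apply,
      LinearMap.smul_apply, Module.End.mul_apply, opOfBasis_single, map_smul, map_add, one_smul,
      mul_zero, zero_add, pow_one, mul_one] at hd hd1 ⊢
    simp only [Nat.reduceAdd] at hd hd1 ⊢
    generalize hdd : p - p⁻¹ = d at *
    generalize hdd1 : p ^ 3 - (p ^ 3)⁻¹ = d1 at *
    generalize ((ε : ℤ) : ℂ) = e at *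
    generalize ((ε' : ℤ) : ℂ) = e' at *
    match_scalars
    all_goals
      field_simp at hdd hdd1 ⊢
      try grind
  · have hd := nonclassical_den_ne hp hq 0
    have hd1 := nonclassical_den_ne hp hq 1
    have hd2 := nonclassical_den_ne hp hq 2
    simp only [nonclassicalT2, nonclassicalT1, LinearMap.sub_apply, LinearMap.zero_apply,
      LinearMap.smul_apply, Module.End.mul_apply, opOfBasis_single, map_smul, map_add, one_smul,
      mul_zero, zero_add, pow_one, mul_one] at hd hd1 hd2 ⊢
    simp only [Nat.reduceMul, Nat.reduceAdd] at hd hd1 hd2 ⊢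
    generalize hdd : p - p⁻¹ = d at *
    generalize hdd1 : p ^ 3 - (p ^ 3)⁻¹ = d1 at *
    generalize hdd2 : p ^ 5 - (p ^ 5)⁻¹ = d2 at *
    generalize ((ε : ℤ) : ℂ) = e at *
    generalize ((ε' : ℤ) : ℂ) = e' at *
    match_scalars
    all_goals
      field_simp at hdd hdd1 hdd2 ⊢
      first
        | grind
        | linear_combination c * Complex.I ^ 2 * r ^ 2 * e * (d2 * p ^ 4 * hdd - d * hdd2)
  · have hd := nonclassical_den_ne hp hq (k + 1)
    have hd1 := nonclassical_den_ne hp hq (k + 2)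
    have hd2 := nonclassical_den_ne hp hq (k + 3)
    have hx : p ^ (2 * k + 1) ≠ 0 := pow_ne_zero _ hp
    simp only [nonclassicalT2, nonclassicalT1, LinearMap.sub_apply, LinearMap.zero_apply,
      LinearMap.smul_apply, Module.End.mul_apply, opOfBasis_single, map_smul, map_add,
      one_smul, add_assoc, Nat.reduceAdd] at hd hd1 hd2 ⊢
    have e1 : p ^ (2 * (k + 1) + 1) = p ^ (2 * k + 1) * p ^ 2 := by ring
    have e2 : p ^ (2 * (k + 2) + 1) = p ^ (2 * k + 1) * p ^ 4 := by ring
    have e3 : p ^ (2 * (k + 3) + 1) = p ^ (2 * k + 1) * p ^ 6 := by ring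
    have e4 : (p ^ 2) ^ (k + 1) = p ^ (2 * k + 1) * p := by ring
    have e5 : (p ^ 2) ^ (k + 2) = p ^ (2 * k + 1) * p ^ 3 := by ring
    have e6 : (p ^ 2) ^ (k + 3) = p ^ (2 * k + 1) * p ^ 5 := by ring
    have e7 : (p ^ 2) ^ (k + 4) = p ^ (2 * k + 1) * p ^ 7 := by ring
    simp only [e1, e2, e3, e4, e5, e6, e7] at hd hd1 hd2 ⊢
    generalize p ^ (2 * k + 1) = x at *
    generalize hdd : x * p ^ 2 - (x * p ^ 2)⁻¹ = d at *
    generalize hdd1 : x * p ^ 4 - (x * p ^ 4)⁻¹ = d1 at *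
    generalize hdd2 : x * p ^ 6 - (x * p ^ 6)⁻¹ = d2 at *
    generalize ((ε : ℤ) : ℂ) = e at *
    match_scalars
    all_goals
      field_simp at hdd hdd1 hdd2 ⊢
      first
        | grind
        | linear_combination c * Complex.I ^ 2 * r ^ 2 * e * (d2 * p ^ 4 * hdd - d * hdd2)

/-- The representation `R_r^{ε,ε'}` on `ℓ²({0, 1, 2, …})`, whose domain is the span of the basis
vectors. -/
noncomputable def nonclassicalRep (p r : ℂ) (ε ε' : ℤˣ) (hp : p ≠ 0)
    (hq : ∀ n : ℕ, 0 < n → (p ^ 2) ^ n ≠ 1) :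
    OperatorRep p (lp (fun _ : ℕ => ℂ) 2) :=
  OperatorRep.ofCoordinates
    (UqIso.lift p (nonclassicalI p ε) (nonclassicalT1 p r ε') (nonclassicalT2 p r ε ε')
      (nonclassical_rel1 hp hq ε ε') (nonclassical_rel2 hp hq ε ε')
      (nonclassical_rel3 hp hq ε ε'))

/-!
The classification rests on two ladder operators that exist without any hypothesis on the spectrum.
Write `i = π(I)` and `t = π(T₂)`. Eliminating `T₁` leaves two cubic relations (`IsCubicPair`). The
first says that `t` maps an eigenvector of `i` to a vector killed by `(i - μ₊)(i - μ₋)`, where `μ₊`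
and `μ₋` are the neighbours of the eigenvalue on a ladder `weight q x n`, `n ∈ ℤ`. Hence the
combinations `raise` and `lower` of `i t` and `t` move eigenvectors one step up or down. Their sum
is `weightGap q x n • t`, and the second cubic relation says exactly that they commute
(`IsCubicPair.lower_raise`).

If a nonzero vector `w` is annihilated by `lower`, the vectors above it span an invariant subspace
(`IsCubicPair.eq_zero_of_lower_eq_zero`), so irreducibility forbids any eigenvalue outside the
upper part of the ladder. Three kinds of ladders `x` remain. If `x² ≠ -q ^ m` for all `m`, the
eigenvalues are distinct; an eigenvector of `lower ∘ raise` in one eigenspace, with eigenvalue `r²`,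
generates a basis on which both operators shift with factor `r`, which is `R_{rs}` with `s = x`,
unless `r = 0` and the representation is one-dimensional. If `x² = -q ^ m`, the ladder can be
shifted so that it is folded at index `0` (`x² = -1`), where `weightGap` vanishes and only one-dimensional
representations survive, or between the indices `-1` and `0` (`x² = -q`), where `lower` maps the
`0`-th eigenspace to itself and an eigenvector of it generates `R_r^{ε,ε'}`. Taking `ε' = 1` is
enough, since `R_r^{ε,-1}` becomes `R_{-r}^{ε,1}` on replacing `|j⟩` by `(-1)^j |j⟩`.
-/

/-! ### Ladder operators -/

/-- The cubic relations between `i = π(I)` and `t = π(T₂)` that remain after `T₁` has been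
eliminated from the defining relations of `U_q(iso₂)`. -/
structure IsCubicPair (q : ℂ) {D : Type*} [AddCommGroup D] [Module ℂ D]
    (i t : Module.End ℂ D) : Prop where
  cubic_left : ∀ v, i (i (t v)) = (q + q⁻¹) • i (t (i v)) - t (i (i v)) - t v
  cubic_right : ∀ v, i (t (t v)) = (q + q⁻¹) • t (i (t v)) - t (t (i v))

/-- Irreducibility of the algebra of operators generated by `i` and `t`. -/
def IsIrreduciblePair {D : Type*} [AddCommGroup D] [Module ℂ D] (i t : Module.End ℂ D) : Prop :=
  ∀ V : Submodule ℂ D, (∀ v ∈ V, i v ∈ V) → (∀ v ∈ V, t v ∈ V) → V = ⊥ ∨ V = ⊤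

/-- The `n`-th eigenvalue `i (x qⁿ - x⁻¹ q⁻ⁿ) / (q - q⁻¹)` of the ladder through the spectral
parameter `x`. -/
noncomputable def weight (q x : ℂ) (n : ℤ) : ℂ :=
  Complex.I * (x * q ^ n - x⁻¹ * q ^ (-n)) / (q - q⁻¹)

/-- The denominator `x qⁿ + x⁻¹ q⁻ⁿ`, which vanishes exactly when the two neighbours of the
`n`-th eigenvalue coincide. -/
noncomputable def weightGap (q x : ℂ) (n : ℤ) : ℂ := x * q ^ n + x⁻¹ * q ^ (-n)

section Weights

variable {q x : ℂ}

theorem weight_recurrence (hq : q ≠ 0) (n : ℤ) :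
    weight q x (n + 1) + weight q x (n - 1) = (q + q⁻¹) * weight q x n := by
  simp only [weight, neg_add, neg_sub, zpow_add₀ hq, zpow_sub₀ hq, zpow_neg, zpow_one]
  field_simp
  ring

theorem weight_add_one_sub (hq : q ≠ 0) (hQ : q - q⁻¹ ≠ 0) (n : ℤ) :
    weight q x (n + 1) - weight q x (n - 1) = Complex.I * weightGap q x n := by
  simp only [weight, weightGap, neg_add, neg_sub, zpow_add₀ hq, zpow_sub₀ hq, zpow_neg, zpow_one]
  rw [← sub_div, div_eq_iff hQ]
  have : q ^ n ≠ 0 := zpow_ne_zero n hq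
  field_simp
  ring

/-- The two neighbours of an eigenvalue are the roots of `X² - (q + q⁻¹) μ X + μ² + 1`. -/
theorem weight_neighbours_mul (hq : q ≠ 0) (hQ : q - q⁻¹ ≠ 0) (hx : x ≠ 0) (n : ℤ) :
    weight q x (n + 1) * weight q x (n - 1) = weight q x n ^ 2 + 1 := by
  simp only [weight, neg_add, neg_sub, zpow_add₀ hq, zpow_sub₀ hq, zpow_neg, zpow_one]
  have : q ^ n ≠ 0 := zpow_ne_zero n hq
  have hI := Complex.I_sq
  generalize q ^ n = u at *
  generalize hd : q - q⁻¹ = d at *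
  field_simp at hd ⊢
  grind

theorem weight_shift (hq : q ≠ 0) (m n : ℤ) :
    weight q (x * q ^ m) n = weight q x (m + n) := by
  simp only [weight, neg_add, zpow_add₀ hq, zpow_neg, mul_inv]
  ring

theorem weightGap_shift (hq : q ≠ 0) (m n : ℤ) :
    weightGap q (x * q ^ m) n = weightGap q x (m + n) := by
  simp only [weightGap, neg_add, zpow_add₀ hq, zpow_neg, mul_inv]
  ring

/-- The involution `x ↦ -x⁻¹` reverses a ladder. -/
theorem weight_neg_inv (n : ℤ) : weight q (-x⁻¹) n = weight q x (-n) := by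
  simp only [weight, neg_neg, inv_neg, inv_inv]
  ring

theorem weightGap_neg_inv (n : ℤ) : weightGap q (-x⁻¹) n = -weightGap q x (-n) := by
  simp only [weightGap, neg_neg, inv_neg, inv_inv]
  ring

/-- A ladder with `x² = -q ^ j` is folded onto itself by the involution `x ↦ -x⁻¹`. -/
theorem weight_fold (hq : q ≠ 0) {j : ℤ} (hx : x ^ 2 = -q ^ j) (n : ℤ) :
    weight q x (-n) = weight q x (-j + n) := by
  have hj : q ^ j ≠ 0 := zpow_ne_zero j hq
  have hx0 : x ≠ 0 := by
    rintro rfl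
    exact hj (by simpa using hx)
  have hinv : -x⁻¹ = x * q ^ (-j) := by
    rw [zpow_neg]
    field_simp
    linear_combination -hx
  rw [← weight_neg_inv, hinv, weight_shift hq]

theorem zpow_ne_one (hr : ∀ n : ℕ, 0 < n → q ^ n ≠ 1) {n : ℤ} (hn : n ≠ 0) : q ^ n ≠ 1 := by
  intro h
  refine hr n.natAbs (Int.natAbs_pos.2 hn) ?_
  rcases Int.natAbs_eq n with h' | h'
  · rw [h', zpow_natCast] at h
    exact h
  · rw [h', zpow_neg, zpow_natCast, inv_eq_one] at h
    exact h

/-- A ladder meets itself only through the involution `x ↦ -x⁻¹`. -/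
theorem eq_of_weight_eq (hq : q ≠ 0) (hr : ∀ n : ℕ, 0 < n → q ^ n ≠ 1) (hQ : q - q⁻¹ ≠ 0)
    (hx : x ≠ 0) {m n : ℤ} (h : weight q x m = weight q x n) :
    m = n ∨ x ^ 2 = -q ^ (-(m + n)) := by
  have hm : q ^ m ≠ 0 := zpow_ne_zero m hq
  have hn : q ^ n ≠ 0 := zpow_ne_zero n hq
  have h1 : (q ^ m - q ^ n) * (x ^ 2 * (q ^ m * q ^ n) + 1) = 0 := by
    simp only [weight, zpow_neg] at h
    rw [div_left_inj' hQ, mul_right_inj' Complex.I_ne_zero] at h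
    generalize q ^ m = u at *
    generalize q ^ n = v at *
    field_simp at h
    linear_combination h
  rcases mul_eq_zero.1 h1 with h2 | h2
  · left
    by_contra hmn
    refine zpow_ne_one hr (sub_ne_zero.2 hmn) ?_
    rw [zpow_sub₀ hq, sub_eq_zero.1 h2, div_self hn]
  · right
    rw [zpow_neg, zpow_add₀ hq]
    field_simp
    linear_combination h2

theorem sq_eq_of_weightGap_eq_zero (hq : q ≠ 0) (hx : x ≠ 0) {n : ℤ}
    (h : weightGap q x n = 0) : x ^ 2 = -q ^ (-(n + n)) := by
  have hn : q ^ n ≠ 0 := zpow_ne_zero n hq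
  simp only [weightGap, zpow_neg] at h
  rw [zpow_neg, zpow_add₀ hq]
  field_simp at h ⊢
  linear_combination h

/-- A ladder that is mapped to itself by the involution `x ↦ -x⁻¹` can be shifted so that it is
folded at index `0` or between the indices `-1` and `0`; its eigenvalues are then those with natural
index. -/
theorem exists_folded_ladder (hq : q ≠ 0) {m : ℤ} (hm : x ^ 2 = -q ^ m) :
    ∃ (y : ℂ) (n : ℕ), (y ^ 2 = -1 ∨ y ^ 2 = -q) ∧ weight q y n = weight q x 0 := by
  have hpow : ∀ k : ℤ, (x * q ^ (-k)) ^ 2 = -q ^ (m - 2 * k) := fun k => by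
    rw [mul_pow, hm, two_mul, sub_eq_add_neg, neg_add, zpow_add₀ hq, zpow_add₀ hq, sq, neg_mul]
  have hshift : ∀ k : ℤ, weight q (x * q ^ (-k)) k = weight q x 0 := fun k => by
    rw [weight_shift hq, neg_add_cancel]
  obtain ⟨k, rfl | rfl⟩ := m.even_or_odd'
  · have hy := hpow k
    rw [sub_self] at hy
    refine ⟨x * q ^ (-k), k.natAbs, Or.inl (by simpa using hy), ?_⟩
    rw [← hshift k]
    rcases Int.natAbs_eq k with h | h
    · rw [← h]
    · rw [← zero_add ((k.natAbs : ℕ) : ℤ), ← neg_zero, ← weight_fold hq hy, ← h]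
  · have hy := hpow k
    rw [add_sub_cancel_left] at hy
    rcases le_or_gt 0 k with h | h
    · exact ⟨x * q ^ (-k), k.toNat, Or.inr (by simpa using hy), by
        rw [Int.toNat_of_nonneg h, hshift]⟩
    · refine ⟨x * q ^ (-k), (-1 + -k).toNat, Or.inr (by simpa using hy), ?_⟩
      rw [Int.toNat_of_nonneg (by omega), ← weight_fold hq hy, neg_neg, hshift]

/-- Every complex number is the initial eigenvalue of some ladder. -/
theorem exists_weight_eq (hQ : q - q⁻¹ ≠ 0) (μ : ℂ) : ∃ x : ℂ, x ≠ 0 ∧ weight q x 0 = μ := by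
  -- `x` is a root of `X² + i (q - q⁻¹) μ X - 1`.
  obtain ⟨δ, hδ⟩ := IsAlgClosed.exists_pow_nat_eq
    ((Complex.I * (q - q⁻¹) * μ) ^ 2 + 4) (n := 2) two_pos
  have hx : (δ - Complex.I * (q - q⁻¹) * μ) / 2 ≠ 0 := by
    intro h
    have h' : δ = Complex.I * (q - q⁻¹) * μ := by linear_combination 2 * h
    rw [h'] at hδ
    norm_num at hδ
  refine ⟨(δ - Complex.I * (q - q⁻¹) * μ) / 2, hx, ?_⟩
  have hroot : ((δ - Complex.I * (q - q⁻¹) * μ) / 2) ^ 2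
      + Complex.I * (q - q⁻¹) * μ * ((δ - Complex.I * (q - q⁻¹) * μ) / 2) - 1 = 0 := by
    linear_combination hδ / 4
  generalize (δ - Complex.I * (q - q⁻¹) * μ) / 2 = x at *
  simp only [weight, zpow_zero, neg_zero, mul_one]
  rw [div_eq_iff hQ]
  generalize q - q⁻¹ = d at *
  have hI := Complex.I_sq
  field_simp
  linear_combination Complex.I * hroot - d * μ * x * hI

end Weights

section Ladder

variable {q x : ℂ} {D : Type*} [AddCommGroup D] [Module ℂ D] {i t : Module.End ℂ D}

/-- The raising operator: on the `n`-th eigenspace of `i` it is `weightGap q x n` times the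
component of `t` in the `n + 1`-st eigenspace. No division is involved, so it makes sense also where
neighbouring eigenvalues coincide. -/
noncomputable def raise (q x : ℂ) (i t : Module.End ℂ D) (n : ℤ) : Module.End ℂ D :=
  -Complex.I • ((i - weight q x (n - 1) • 1) * t)

/-- The lowering operator: on the `n`-th eigenspace of `i` it is `weightGap q x n` times the
component of `t` in the `n - 1`-st eigenspace. -/
noncomputable def lower (q x : ℂ) (i t : Module.End ℂ D) (n : ℤ) : Module.End ℂ D :=
  Complex.I • ((i - weight q x (n + 1) • 1) * t)

theorem raise_apply (n : ℤ) (v : D) :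
    raise q x i t n v = -Complex.I • (i (t v) - weight q x (n - 1) • t v) := by
  simp [raise]

theorem lower_apply (n : ℤ) (v : D) :
    lower q x i t n v = Complex.I • (i (t v) - weight q x (n + 1) • t v) := by
  simp [lower]

theorem raise_add_lower (hq : q ≠ 0) (hQ : q - q⁻¹ ≠ 0) (n : ℤ) (v : D) :
    raise q x i t n v + lower q x i t n v = weightGap q x n • t v := by
  have h := weight_add_one_sub (x := x) hq hQ n
  have hI := Complex.I_mul_I
  rw [raise_apply, lower_apply]
  match_scalars
  · ring
  · linear_combination -Complex.I * h - weightGap q x n * hI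

theorem lower_neg_inv (n : ℤ) : lower q (-x⁻¹) i t n = -raise q x i t (-n) := by
  rw [lower, raise, weight_neg_inv, neg_add, ← sub_eq_add_neg, neg_smul, neg_neg]

theorem raise_neg_inv (n : ℤ) : raise q (-x⁻¹) i t n = -lower q x i t (-n) := by
  rw [lower, raise, weight_neg_inv, neg_sub, ← sub_eq_neg_add, neg_smul, sub_eq_add_neg, add_comm]

theorem IsCubicPair.raise_mem (h : IsCubicPair q i t) (hq : q ≠ 0) (hQ : q - q⁻¹ ≠ 0)
    (hx : x ≠ 0) {n : ℤ} {v : D} (hv : i v = weight q x n • v) :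
    i (raise q x i t n v) = weight q x (n + 1) • raise q x i t n v := by
  have h1 := weight_recurrence (x := x) hq n
  have h2 := weight_neighbours_mul hq hQ hx n
  simp only [raise_apply, map_smul, map_sub, h.cubic_left, hv]
  match_scalars
  · linear_combination Complex.I * h1
  · linear_combination -Complex.I * h2

theorem IsCubicPair.lower_mem (h : IsCubicPair q i t) (hq : q ≠ 0) (hQ : q - q⁻¹ ≠ 0)
    (hx : x ≠ 0) {n : ℤ} {v : D} (hv : i v = weight q x n • v) :
    i (lower q x i t n v) = weight q x (n - 1) • lower q x i t n v := by
  have h1 := weight_recurrence (x := x) hq n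
  have h2 := weight_neighbours_mul hq hQ hx n
  simp only [lower_apply, map_smul, map_sub, h.cubic_left, hv]
  match_scalars
  · linear_combination -Complex.I * h1
  · linear_combination Complex.I * h2

/-- Raising and lowering commute; this is the content of the relation `[T₂, T₁]_q = 0`. -/
theorem IsCubicPair.lower_raise (h : IsCubicPair q i t) (hq : q ≠ 0)
    {n : ℤ} {v : D} (hv : i v = weight q x n • v) :
    lower q x i t (n + 1) (raise q x i t n v) = raise q x i t (n - 1) (lower q x i t n v) := by
  have h1 := weight_recurrence (x := x) hq n
  have h2 := weight_recurrence (x := x) hq (n + 1)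
  have h3 := weight_recurrence (x := x) hq (n - 1)
  rw [add_sub_cancel_right] at h2
  rw [sub_add_cancel] at h3
  simp only [raise_apply, lower_apply, map_smul, map_sub, h.cubic_right, hv]
  have hI := Complex.I_mul_I
  match_scalars
  · ring
  · linear_combination Complex.I ^ 2 * (h2 - h3)
  · linear_combination (-Complex.I ^ 2) * (weight q x (n - 1) * h2 - weight q x (n + 1) * h3)

end Ladder

/-! ### Invariant spans of eigenvectors -/

section Span

variable {D : Type*} [AddCommGroup D] [Module ℂ D] {i t : Module.End ℂ D}

theorem map_mem_span_range {ι : Type*} {e : ι → D} {f : Module.End ℂ D}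
    (h : ∀ k, f (e k) ∈ Submodule.span ℂ (Set.range e)) :
    ∀ v ∈ Submodule.span ℂ (Set.range e), f v ∈ Submodule.span ℂ (Set.range e) := by
  have : Submodule.span ℂ (Set.range e) ≤ (Submodule.span ℂ (Set.range e)).comap f := by
    rw [Submodule.span_le]
    rintro _ ⟨k, rfl⟩
    exact h k
  exact this

theorem IsIrreduciblePair.span_eq_top (hirr : IsIrreduciblePair i t) {ι : Type*} {e : ι → D}
    {μ : ι → ℂ} (hi : ∀ k, i (e k) = μ k • e k)
    (ht : ∀ k, t (e k) ∈ Submodule.span ℂ (Set.range e)) (k : ι) (hk : e k ≠ 0) :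
    Submodule.span ℂ (Set.range e) = ⊤ := by
  have hmem : ∀ k, e k ∈ Submodule.span ℂ (Set.range e) := fun k =>
    Submodule.subset_span ⟨k, rfl⟩
  refine (hirr _ (map_mem_span_range fun k => ?_) (map_mem_span_range ht)).resolve_left ?_
  · rw [hi]
    exact Submodule.smul_mem _ _ (hmem k)
  · intro h
    have := hmem k
    rw [h, Submodule.mem_bot] at this
    exact hk this

theorem IsIrreduciblePair.finrank_eq_one (hirr : IsIrreduciblePair i t) {μ : ℂ} {v : D}
    (hv : v ≠ 0) (hi : i v = μ • v) (ht : t v = 0) : Module.finrank ℂ D = 1 := by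
  have h := hirr.span_eq_top (e := fun _ : Unit => v) (μ := fun _ => μ) (fun _ => hi)
    (fun _ => by rw [ht]; exact Submodule.zero_mem _) () hv
  rw [Set.range_const] at h
  rw [← finrank_top ℂ D, ← h, finrank_span_singleton hv]

/-- Eigenvectors of `i` with distinct eigenvalues whose span is stable under `t` are a basis. -/
theorem IsIrreduciblePair.exists_basis (hirr : IsIrreduciblePair i t) {ι : Type*} [Nonempty ι]
    {e : ι → D} {μ : ι → ℂ} (hμ : Function.Injective μ) (he : ∀ k, e k ≠ 0)
    (hi : ∀ k, i (e k) = μ k • e k)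
    (ht : ∀ k, t (e k) ∈ Submodule.span ℂ (Set.range e)) :
    ∃ b : Module.Basis ι ℂ D, ∀ k, b k = e k := by
  have hli : LinearIndependent ℂ e :=
    Module.End.eigenvectors_linearIndependent' i μ hμ e fun k =>
      ⟨Module.End.mem_eigenspace_iff.2 (hi k), he k⟩
  have k : ι := Classical.arbitrary ι
  exact ⟨Module.Basis.mk hli (hirr.span_eq_top hi ht k (he k)).ge, fun k => by simp⟩

/-- An eigenvalue that is attained occurs in every family of eigenvectors that spans an invariant
subspace, unless the family vanishes. -/
theorem IsIrreduciblePair.eq_zero_of_ne (hirr : IsIrreduciblePair i t) {ι : Type*} {e : ι → D}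
    {μ : ι → ℂ} (hi : ∀ k, i (e k) = μ k • e k)
    (ht : ∀ k, t (e k) ∈ Submodule.span ℂ (Set.range e))
    {ν : ℂ} {v : D} (hv : v ≠ 0) (hiv : i v = ν • v) (hν : ∀ k, μ k ≠ ν) (k : ι) : e k = 0 := by
  by_contra hk
  have htop := hirr.span_eq_top hi ht k hk
  have hle : Submodule.span ℂ (Set.range e) ≤ ⨆ (μ' : ℂ) (_ : μ' ≠ ν), i.eigenspace μ' := by
    rw [Submodule.span_le]
    rintro _ ⟨k, rfl⟩
    exact Submodule.mem_iSup_of_mem (μ k) (Submodule.mem_iSup_of_mem (hν k)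
      (Module.End.mem_eigenspace_iff.2 (hi k)))
  rw [htop] at hle
  exact hv (Submodule.disjoint_def.1 (i.eigenspaces_iSupIndep ν) v
    (Module.End.mem_eigenspace_iff.2 hiv) (hle trivial))

end Span

/-! ### Half-infinite ladders -/

section HalfLadder

variable {q x : ℂ} {D : Type*} [AddCommGroup D] [Module ℂ D] {i t : Module.End ℂ D}

/-- The vectors obtained from `v`, in the `0`-th eigenspace, by climbing up the ladder. -/
noncomputable def climb (q x : ℂ) (i t : Module.End ℂ D) (v : D) : ℕ → D
  | 0 => v
  | k + 1 => raise q x i t k (climb q x i t v k)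

theorem lower_shift (hq : q ≠ 0) (m n : ℤ) :
    lower q (x * q ^ m) i t n = lower q x i t (m + n) := by
  rw [lower, lower, weight_shift hq, add_assoc]

theorem IsCubicPair.climb_mem (h : IsCubicPair q i t) (hq : q ≠ 0) (hQ : q - q⁻¹ ≠ 0)
    (hx : x ≠ 0) {v : D} (hv : i v = weight q x 0 • v) (k : ℕ) :
    i (climb q x i t v k) = weight q x k • climb q x i t v k := by
  induction k with
  | zero => simpa [climb] using hv
  | succ k ih =>
    rw [Nat.cast_succ]
    exact h.raise_mem hq hQ hx ih

theorem IsCubicPair.lower_climb (h : IsCubicPair q i t) (hq : q ≠ 0) (hQ : q - q⁻¹ ≠ 0)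
    (hx : x ≠ 0) {v : D} (hv : i v = weight q x 0 • v) {c : ℂ}
    (hc : lower q x i t 1 (raise q x i t 0 v) = c • v) (k : ℕ) :
    lower q x i t (k + 1) (climb q x i t v (k + 1)) = c • climb q x i t v k := by
  induction k with
  | zero => simpa [climb] using hc
  | succ k ih =>
    rw [climb, h.lower_raise hq (h.climb_mem hq hQ hx hv (k + 1)), Nat.cast_succ,
      add_sub_cancel_right, ih, map_smul, climb]

/-- In an irreducible pair, a lowest vector of a ladder vanishes as soon as some eigenvalue lies
off the part of the ladder above it. -/
theorem IsCubicPair.eq_zero_of_lower_eq_zero (h : IsCubicPair q i t)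
    (hirr : IsIrreduciblePair i t) (hq : q ≠ 0) (hQ : q - q⁻¹ ≠ 0) (hx : x ≠ 0)
    (hgap : ∀ k : ℕ, weightGap q x k ≠ 0) {w : D} (hw : i w = weight q x 0 • w)
    (hl : lower q x i t 0 w = 0) {ν : ℂ} {v : D} (hv : v ≠ 0) (hiv : i v = ν • v)
    (hν : ∀ k : ℕ, weight q x k ≠ ν) : w = 0 := by
  have hc : lower q x i t 1 (raise q x i t 0 w) = (0 : ℂ) • w := by
    have := h.lower_raise hq hw
    rwa [hl, map_zero, zero_add, ← zero_smul ℂ w] at this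
  have hlow : ∀ k : ℕ, lower q x i t k (climb q x i t w k) = 0 := by
    rintro (_ | k)
    · simpa [climb] using hl
    · rw [Nat.cast_succ, h.lower_climb hq hQ hx hw hc, zero_smul]
  refine hirr.eq_zero_of_ne (e := climb q x i t w) (h.climb_mem hq hQ hx hw) (fun k => ?_)
    hv hiv hν 0
  have ht := raise_add_lower (x := x) (i := i) (t := t) hq hQ k (climb q x i t w k)
  rw [hlow, add_zero, ← climb] at ht
  rw [← Submodule.smul_mem_iff _ (hgap k), ← ht]
  exact Submodule.subset_span ⟨k + 1, rfl⟩

/-- In an irreducible pair, `t` does not raise an eigenvector on which lowering after raising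
vanishes. -/
theorem IsCubicPair.raise_eq_zero (h : IsCubicPair q i t)
    (hirr : IsIrreduciblePair i t) (hq : q ≠ 0) (hQ : q - q⁻¹ ≠ 0) (hx : x ≠ 0)
    (hgap : ∀ k : ℕ, weightGap q x (k + 1) ≠ 0)
    (hne : ∀ k : ℕ, weight q x (k + 1) ≠ weight q x 0)
    {v : D} (hv : v ≠ 0) (hiv : i v = weight q x 0 • v)
    (hl : lower q x i t 1 (raise q x i t 0 v) = 0) : raise q x i t 0 v = 0 := by
  have hx' : x * q ^ (1 : ℤ) ≠ 0 := mul_ne_zero hx (zpow_ne_zero 1 hq)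
  refine h.eq_zero_of_lower_eq_zero (x := x * q ^ (1 : ℤ)) hirr hq hQ hx' (fun k => ?_) ?_ ?_ hv
    hiv (fun k => ?_)
  · rw [weightGap_shift hq, add_comm]
    exact hgap k
  · rw [weight_shift hq, h.raise_mem hq hQ hx hiv, add_comm]
  · rwa [lower_shift hq, add_zero]
  · rw [weight_shift hq, add_comm]
    exact hne k

/-- If lowering after raising is a nonzero scalar `r²` on `v`, the rescaled vectors above `v` form a
half-infinite ladder along which both ladder operators are multiplication by `r`. -/
theorem IsCubicPair.exists_half_ladder (h : IsCubicPair q i t) (hq : q ≠ 0) (hQ : q - q⁻¹ ≠ 0)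
    (hx : x ≠ 0) {v : D} (hv : v ≠ 0) (hiv : i v = weight q x 0 • v) {r : ℂ} (hr : r ≠ 0)
    (hc : lower q x i t 1 (raise q x i t 0 v) = r ^ 2 • v) :
    ∃ e : ℕ → D, e 0 = v ∧ (∀ k, e k ≠ 0) ∧ (∀ k : ℕ, i (e k) = weight q x k • e k) ∧
      (∀ k : ℕ, raise q x i t k (e k) = r • e (k + 1)) ∧
      ∀ k : ℕ, lower q x i t (k + 1) (e (k + 1)) = r • e k := by
  have hlow := h.lower_climb hq hQ hx hiv hc
  have hne : ∀ k, climb q x i t v k ≠ 0 := by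
    intro k
    induction k with
    | zero => exact hv
    | succ k ih =>
      intro h0
      have := hlow k
      rw [h0, map_zero] at this
      exact smul_ne_zero (pow_ne_zero 2 hr) ih this.symm
  refine ⟨fun k => (r ^ k)⁻¹ • climb q x i t v k, by simp [climb], fun k => ?_, fun k => ?_,
    fun k => ?_, fun k => ?_⟩
  · exact smul_ne_zero (inv_ne_zero (pow_ne_zero k hr)) (hne k)
  · rw [map_smul, h.climb_mem hq hQ hx hiv, smul_comm]
  · rw [map_smul, ← climb, smul_smul]
    congr 1
    field_simp
    ring
  · rw [map_smul, hlow, smul_smul, smul_smul]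
    congr 1
    field_simp
    ring

end HalfLadder

/-! ### The three kinds of ladders -/

section Classification

variable {q x : ℂ} {D : Type*} [AddCommGroup D] [Module ℂ D] {i t : Module.End ℂ D}

/-- Ladders without coincidences. Lowering after raising commutes with everything, and its
eigenvalue `r²` on an eigenvector is either zero, when `t` annihilates the vector by irreducibility, or makes
the two half-infinite ladders starting at that vector into a basis. -/
theorem IsCubicPair.classical_alternative (h : IsCubicPair q i t) (hirr : IsIrreduciblePair i t)
    (hq : q ≠ 0) (hroot : ∀ n : ℕ, 0 < n → q ^ n ≠ 1) (hQ : q - q⁻¹ ≠ 0) (hx : x ≠ 0)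
    (hgen : ∀ m : ℤ, x ^ 2 ≠ -q ^ m) [FiniteDimensional ℂ (i.eigenspace (weight q x 0))]
    {v : D} (hv : v ≠ 0) (hiv : i v = weight q x 0 • v) :
    Module.finrank ℂ D = 1 ∨ ∃ r : ℂ, r ≠ 0 ∧ ∃ b : Module.Basis ℤ ℂ D,
      (∀ n, i (b n) = weight q x n • b n) ∧
      ∀ n, t (b n) = (r / weightGap q x n) • (b (n + 1) + b (n - 1)) := by
  have hgap : ∀ n, weightGap q x n ≠ 0 := fun n hn => hgen _ (sq_eq_of_weightGap_eq_zero hq hx hn)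
  have hinj : Function.Injective (weight q x) := fun m n hmn =>
    (eq_of_weight_eq hq hroot hQ hx hmn).resolve_right (hgen _)
  have hx' : -x⁻¹ ≠ 0 := neg_ne_zero.2 (inv_ne_zero hx)
  -- `lower 1 ∘ raise 0` preserves the finite-dimensional `0`-th eigenspace.
  have hmaps : Set.MapsTo (lower q x i t 1 * raise q x i t 0)
      (i.eigenspace (weight q x 0)) (i.eigenspace (weight q x 0)) := by
    intro u hu
    have hu := Module.End.mem_eigenspace_iff.1 hu
    have := h.lower_mem hq hQ hx (h.raise_mem hq hQ hx hu)
    exact Module.End.mem_eigenspace_iff.2 (by simpa using this)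
  have : Nontrivial (i.eigenspace (weight q x 0)) :=
    ⟨⟨v, Module.End.mem_eigenspace_iff.2 hiv⟩, 0, fun h0 => hv (congrArg Subtype.val h0)⟩
  obtain ⟨c, hc⟩ := Module.End.exists_eigenvalue
    ((lower q x i t 1 * raise q x i t 0).restrict hmaps)
  obtain ⟨⟨w, hw⟩, hwc⟩ := hc.exists_hasEigenvector
  have hiw := Module.End.mem_eigenspace_iff.1 hw
  have hw0 : w ≠ 0 := fun h0 => hwc.2 (Subtype.ext h0)
  have hcw : lower q x i t 1 (raise q x i t 0 w) = c • w :=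
    congrArg Subtype.val hwc.apply_eq_smul
  have hiw' : i w = weight q (-x⁻¹) 0 • w := by rw [weight_neg_inv, neg_zero, hiw]
  have hcw' : lower q (-x⁻¹) i t 1 (raise q (-x⁻¹) i t 0 w) = c • w := by
    rw [lower_neg_inv, raise_neg_inv, ← hcw]
    simpa using (h.lower_raise hq hiw).symm
  by_cases hc0 : c = 0
  · left
    rw [hc0, zero_smul] at hcw hcw'
    have hr := h.raise_eq_zero hirr hq hQ hx (fun k => hgap _)
      (fun k hk => by have := hinj hk; omega) hw0 hiw hcw
    have hl := h.raise_eq_zero hirr hq hQ hx'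
      (fun k => by rw [weightGap_neg_inv]; exact neg_ne_zero.2 (hgap _))
      (fun k hk => by rw [weight_neg_inv, weight_neg_inv] at hk; have := hinj hk; omega)
      hw0 hiw' hcw'
    rw [raise_neg_inv, neg_zero, LinearMap.neg_apply, neg_eq_zero] at hl
    have ht := raise_add_lower (x := x) (i := i) (t := t) hq hQ 0 w
    rw [hr, hl, add_zero, eq_comm, smul_eq_zero] at ht
    exact hirr.finrank_eq_one hw0 hiw (ht.resolve_left (hgap 0))
  right
  obtain ⟨r, rfl⟩ := IsAlgClosed.exists_pow_nat_eq c two_pos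
  have hr : r ≠ 0 := fun h0 => hc0 (by simp [h0])
  obtain ⟨a, ha0, hane, hai, hau, had⟩ := h.exists_half_ladder hq hQ hx hw0 hiw hr hcw
  -- The lower half is the upper half of the reversed ladder. Reversal changes the sign of both
  -- ladder operators, whence the square root `-r`.
  obtain ⟨a', ha0', hane', hai', hau', had'⟩ :=
    h.exists_half_ladder (r := -r) hq hQ hx' hw0 hiw' (neg_ne_zero.2 hr) (by rwa [neg_sq])
  have hau' : ∀ k : ℕ, lower q x i t (-k) (a' k) = r • a' (k + 1) := fun k => by
    have := hau' k
    rwa [raise_neg_inv, LinearMap.neg_apply, neg_smul, neg_inj] at this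
  have had' : ∀ k : ℕ, raise q x i t (-(k + 1)) (a' (k + 1)) = r • a' k := fun k => by
    have := had' k
    rwa [lower_neg_inv, LinearMap.neg_apply, neg_smul, neg_inj] at this
  let e : ℤ → D := fun n => match n with
    | Int.ofNat k => a k
    | Int.negSucc k => a' (k + 1)
  have hepos : ∀ k : ℕ, e k = a k := fun k => rfl
  have heneg : ∀ k : ℕ, e (-k) = a' k := by
    rintro (_ | k)
    · exact ha0.trans ha0'.symm
    · rfl
  have hei : ∀ n, i (e n) = weight q x n • e n := by
    intro n
    obtain ⟨k, rfl | rfl⟩ := n.eq_nat_or_neg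
    · exact hai k
    · rw [heneg, hai', weight_neg_inv]
  have hene : ∀ n, e n ≠ 0 := by
    intro n
    obtain ⟨k, rfl | rfl⟩ := n.eq_nat_or_neg
    · exact hane k
    · rw [heneg]
      exact hane' k
  have heu : ∀ n, raise q x i t n (e n) = r • e (n + 1) := by
    intro n
    obtain ⟨k, rfl | rfl⟩ := n.eq_nat_or_neg
    · exact hau k
    · rcases k with _ | k
      · exact hau 0
      · have e1 : (-((k + 1 : ℕ) : ℤ)) + 1 = -(k : ℤ) := by push_cast; ring
        rw [e1, heneg, heneg, Nat.cast_succ]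
        exact had' k
  have hed : ∀ n, lower q x i t n (e n) = r • e (n - 1) := by
    intro n
    obtain ⟨k, rfl | rfl⟩ := n.eq_nat_or_neg
    · rcases k with _ | k
      · have := hau' 0
        rw [← heneg, ← heneg] at this
        exact this
      · rw [Nat.cast_succ, add_sub_cancel_right]
        exact had k
    · have e1 : (-(k : ℤ)) - 1 = -((k + 1 : ℕ) : ℤ) := by push_cast; ring
      rw [e1, heneg, heneg]
      exact hau' k
  have het : ∀ n, t (e n) = (r / weightGap q x n) • (e (n + 1) + e (n - 1)) := by
    intro n
    have ht := raise_add_lower (x := x) (i := i) (t := t) hq hQ n (e n)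
    rw [heu, hed, ← smul_add] at ht
    rw [div_eq_inv_mul, mul_smul, ht, inv_smul_smul₀ (hgap n)]
  obtain ⟨b, hb⟩ := hirr.exists_basis hinj hene hei fun n => by
    rw [het]
    exact Submodule.smul_mem _ _ (Submodule.add_mem _ (Submodule.subset_span ⟨_, rfl⟩)
      (Submodule.subset_span ⟨_, rfl⟩))
  exact ⟨r, hr, b, fun n => by rw [hb, hei], fun n => by rw [hb, hb, hb, het]⟩

/-- A lowest vector is annihilated by `t`. -/
theorem IsCubicPair.finrank_eq_one_of_lower_eq_zero (h : IsCubicPair q i t)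
    (hirr : IsIrreduciblePair i t) (hq : q ≠ 0) (hQ : q - q⁻¹ ≠ 0) (hx : x ≠ 0)
    (hgap : ∀ k : ℕ, weightGap q x k ≠ 0)
    (hne : ∀ k : ℕ, weight q x (k + 1) ≠ weight q x 0)
    {v : D} (hv : v ≠ 0) (hiv : i v = weight q x 0 • v) (hl : lower q x i t 0 v = 0) :
    Module.finrank ℂ D = 1 := by
  have hr := h.raise_eq_zero hirr hq hQ hx (fun k => by exact_mod_cast hgap (k + 1)) hne hv hiv
    (by simpa [hl] using h.lower_raise hq hiv)
  have ht := raise_add_lower (x := x) (i := i) (t := t) hq hQ 0 v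
  rw [hr, hl, add_zero, eq_comm, smul_eq_zero] at ht
  exact hirr.finrank_eq_one hv hiv (ht.resolve_left (by exact_mod_cast hgap 0))

/-- If an eigenvalue of a ladder with injective upper half is attained, then either the pair is
one-dimensional or already the `0`-th eigenvalue is attained. -/
theorem IsCubicPair.finrank_eq_one_or_exists_zero (h : IsCubicPair q i t)
    (hirr : IsIrreduciblePair i t) (hq : q ≠ 0) (hQ : q - q⁻¹ ≠ 0) (hx : x ≠ 0)
    (hgap : ∀ k : ℕ, weightGap q x (k + 1) ≠ 0)
    (hinj : ∀ m n : ℕ, weight q x m = weight q x n → m = n)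
    (hex : ∃ n : ℕ, ∃ v : D, v ≠ 0 ∧ i v = weight q x n • v) :
    Module.finrank ℂ D = 1 ∨ ∃ v : D, v ≠ 0 ∧ i v = weight q x 0 • v := by
  classical
  -- The eigenvectors for the smallest index that occurs are lowest vectors.
  obtain ⟨v, hv, hiv⟩ := Nat.find_spec hex
  have hmin : ∀ m < Nat.find hex, ¬∃ v : D, v ≠ 0 ∧ i v = weight q x m • v :=
    fun m hm => Nat.find_min hex hm
  generalize Nat.find hex = n at hiv hmin
  rcases n with _ | n
  · exact Or.inr ⟨v, hv, hiv⟩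
  left
  have hlow : lower q x i t (n + 1 : ℕ) v = 0 := by
    by_contra hne
    refine hmin n (Nat.lt_succ_self n) ⟨_, hne, ?_⟩
    have := h.lower_mem hq hQ hx hiv
    rwa [Nat.cast_succ, add_sub_cancel_right] at this
  refine h.finrank_eq_one_of_lower_eq_zero (x := x * q ^ ((n + 1 : ℕ) : ℤ)) hirr hq hQ
    (mul_ne_zero hx (zpow_ne_zero _ hq)) (fun k => ?_) (fun k hk => ?_) hv ?_ ?_
  · rw [weightGap_shift hq]
    have := hgap (n + k)
    push_cast at this ⊢
    rwa [add_right_comm]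
  · rw [weight_shift hq, weight_shift hq, add_zero] at hk
    have := hinj (n + 1 + (k + 1)) (n + 1) (by exact_mod_cast hk)
    omega
  · rw [weight_shift hq, add_zero, hiv]
  · rw [lower_shift hq, add_zero, hlow]

/-- The ladders through `x = ±i` fold at their `0`-th eigenvalue, whose two neighbours coincide.
They carry only one-dimensional irreducible pairs; the absence of Jordan blocks
is needed at the fold. -/
theorem IsCubicPair.finrank_eq_one_of_sq_eq_neg_one (h : IsCubicPair q i t)
    (hirr : IsIrreduciblePair i t) (hq : q ≠ 0) (hroot : ∀ n : ℕ, 0 < n → q ^ n ≠ 1)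
    (hQ : q - q⁻¹ ≠ 0) (hx : x ^ 2 = -1)
    (hjordan : ∀ (μ : ℂ) (v : D), i (i v - μ • v) = μ • (i v - μ • v) → i v = μ • v)
    (hex : ∃ n : ℕ, ∃ v : D, v ≠ 0 ∧ i v = weight q x n • v) : Module.finrank ℂ D = 1 := by
  have hx0 : x ≠ 0 := by rintro rfl; norm_num at hx
  have hinj : ∀ m n : ℕ, weight q x m = weight q x n → m = n := by
    intro m n hmn
    rcases eq_of_weight_eq hq hroot hQ hx0 hmn with h1 | h1
    · exact_mod_cast h1
    · rw [hx, neg_inj] at h1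
      by_contra hne
      exact zpow_ne_one hroot (by omega) h1.symm
  have hgap : ∀ k : ℕ, weightGap q x (k + 1) ≠ 0 := by
    intro k hk
    have h1 := sq_eq_of_weightGap_eq_zero hq hx0 hk
    rw [hx, neg_inj] at h1
    exact zpow_ne_one hroot (by omega) h1.symm
  rcases h.finrank_eq_one_or_exists_zero hirr hq hQ hx0 hgap hinj hex with h1 | ⟨v, hv, hiv⟩
  · exact h1
  have hfold : weight q x (-1) = weight q x 1 := by
    simpa using weight_fold hq (j := 0) (by simpa using hx) 1
  have hrec := weight_recurrence (x := x) hq 0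
  have hmul := weight_neighbours_mul hq hQ hx0 0
  have hrec1 := weight_recurrence (x := x) hq 1
  simp only [zero_add, zero_sub, hfold] at hrec hmul
  norm_num at hrec1
  -- Both neighbours are `weight q x 1`, so the first cubic relation reads
  -- `(i - weight q x 1)² t v = 0`.
  have hit : i (t v) = weight q x 1 • t v := by
    apply hjordan
    simp only [map_sub, map_smul, h.cubic_left, hiv]
    match_scalars
    · linear_combination -hrec
    · linear_combination hmul
  have hitt : i (t (t v)) = weight q x 2 • t (t v) := by
    simp only [h.cubic_right, hit, hiv, map_smul]
    match_scalars
    linear_combination -hrec1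
  -- So `t v` is a lowest vector at index `1`, although it comes from index `0`.
  have ht : t v = 0 := by
    refine h.eq_zero_of_lower_eq_zero (x := x * q ^ (1 : ℤ)) hirr hq hQ
      (mul_ne_zero hx0 (zpow_ne_zero 1 hq)) (fun k => ?_) ?_ ?_ hv hiv (fun k hk => ?_)
    · rw [weightGap_shift hq, add_comm]
      exact hgap k
    · rw [weight_shift hq, hit, add_zero]
    · rw [lower_shift hq, lower_apply]
      norm_num [hitt]
    · rw [weight_shift hq] at hk
      have := hinj (1 + k) 0 (by exact_mod_cast hk)
      omega
  exact hirr.finrank_eq_one hv hiv ht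

/-- The ladders through `x = ±i q^{1/2}` fold between the indices `-1` and `0`, so that lowering
maps the `0`-th eigenspace to itself. If `c ≠ 0` is an eigenvalue of this map then
`lower 1 ∘ raise 0` is multiplication by `(i c)²` on the eigenvector. -/
theorem IsCubicPair.nonclassical_alternative (h : IsCubicPair q i t)
    (hirr : IsIrreduciblePair i t) (hq : q ≠ 0) (hroot : ∀ n : ℕ, 0 < n → q ^ n ≠ 1)
    (hQ : q - q⁻¹ ≠ 0) (hx : x ^ 2 = -q) [FiniteDimensional ℂ (i.eigenspace (weight q x 0))]
    (hex : ∃ n : ℕ, ∃ v : D, v ≠ 0 ∧ i v = weight q x n • v) :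
    Module.finrank ℂ D = 1 ∨ ∃ r : ℂ, r ≠ 0 ∧ ∃ b : Module.Basis ℕ ℂ D,
      (∀ n : ℕ, i (b n) = weight q x n • b n) ∧
      t (b 0) = (r / weightGap q x 0) • (b 1 - Complex.I • b 0) ∧
      ∀ n : ℕ, t (b (n + 1)) = (r / weightGap q x (n + 1)) • (b (n + 2) + b n) := by
  have hx0 : x ≠ 0 := by rintro rfl; exact hq (by simpa using hx)
  have hsq : ∀ m : ℤ, m + 1 ≠ 0 → x ^ 2 ≠ -q ^ (-m) := by
    intro m hm h1
    rw [hx, neg_inj] at h1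
    refine zpow_ne_one hroot hm ?_
    rw [zpow_add_one₀ hq]
    nth_rewrite 2 [h1]
    rw [← zpow_add₀ hq, add_neg_cancel, zpow_zero]
  have hinj : ∀ m n : ℕ, weight q x m = weight q x n → m = n := by
    intro m n hmn
    rcases eq_of_weight_eq hq hroot hQ hx0 hmn with h1 | h1
    · exact_mod_cast h1
    · exact absurd h1 (hsq _ (by omega))
  have hgap : ∀ k : ℕ, weightGap q x k ≠ 0 := fun k hk =>
    hsq _ (by omega) (sq_eq_of_weightGap_eq_zero hq hx0 hk)
  rcases h.finrank_eq_one_or_exists_zero hirr hq hQ hx0 (fun k => by exact_mod_cast hgap (k + 1))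
    hinj hex with h1 | ⟨v, hv, hiv⟩
  · exact Or.inl h1
  have hfold : ∀ n, weight q x (-n) = weight q x (-1 + n) :=
    weight_fold hq (by simpa using hx)
  -- Index `-1` is index `0` again, and there raising is minus lowering at index `0`.
  have hraise : raise q x i t (-1) = -lower q x i t 0 := by
    have := hfold 2
    norm_num at this
    rw [raise, lower, zero_add, neg_smul]
    norm_num [this]
  have hlmem : ∀ u, i u = weight q x 0 • u →
      i (lower q x i t 0 u) = weight q x 0 • lower q x i t 0 u := by
    intro u hu
    have := h.lower_mem hq hQ hx0 hu
    rwa [show weight q x (0 - 1) = weight q x 0 by simpa using hfold 1] at this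
  have hmaps : Set.MapsTo (lower q x i t 0)
      (i.eigenspace (weight q x 0)) (i.eigenspace (weight q x 0)) := fun u hu =>
    Module.End.mem_eigenspace_iff.2 (hlmem u (Module.End.mem_eigenspace_iff.1 hu))
  have : Nontrivial (i.eigenspace (weight q x 0)) :=
    ⟨⟨v, Module.End.mem_eigenspace_iff.2 hiv⟩, 0, fun h0 => hv (congrArg Subtype.val h0)⟩
  obtain ⟨c, hc⟩ := Module.End.exists_eigenvalue ((lower q x i t 0).restrict hmaps)
  obtain ⟨⟨w, hw⟩, hwc⟩ := hc.exists_hasEigenvector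
  have hiw := Module.End.mem_eigenspace_iff.1 hw
  have hw0 : w ≠ 0 := fun h0 => hwc.2 (Subtype.ext h0)
  have hcw : lower q x i t 0 w = c • w := congrArg Subtype.val hwc.apply_eq_smul
  by_cases hc0 : c = 0
  · left
    refine h.finrank_eq_one_of_lower_eq_zero hirr hq hQ hx0 hgap (fun k hk => ?_) hw0 hiw
      (by rw [hcw, hc0, zero_smul])
    have := hinj (k + 1) 0 (by exact_mod_cast hk)
    omega
  right
  have hI := Complex.I_sq
  have hr : Complex.I * c ≠ 0 := mul_ne_zero Complex.I_ne_zero hc0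
  have hcw' : lower q x i t 1 (raise q x i t 0 w) = (Complex.I * c) ^ 2 • w := by
    have := h.lower_raise hq hiw
    rw [zero_add, zero_sub, hraise, hcw, LinearMap.neg_apply, map_smul, hcw] at this
    rw [this, mul_pow, hI, smul_smul, ← neg_smul]
    congr 1
    ring
  obtain ⟨e, he0, hene, hei, heu, hed⟩ := h.exists_half_ladder hq hQ hx0 hw0 hiw hr hcw'
  have ht0 : t (e 0) = (Complex.I * c / weightGap q x 0) • (e 1 - Complex.I • e 0) := by
    have ht := raise_add_lower (x := x) (i := i) (t := t) hq hQ 0 (e 0)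
    have hl : lower q x i t 0 (e 0) = -(Complex.I * c) • Complex.I • e 0 := by
      rw [he0, hcw, smul_smul]
      congr 1
      linear_combination c * hI
    rw [show raise q x i t 0 (e 0) = (Complex.I * c) • e 1 from heu 0, hl, neg_smul,
      ← sub_eq_add_neg, ← smul_sub] at ht
    rw [div_eq_inv_mul, mul_smul, ht, inv_smul_smul₀ (by exact_mod_cast hgap 0)]
  have ht1 : ∀ n : ℕ, t (e (n + 1)) =
      (Complex.I * c / weightGap q x (n + 1)) • (e (n + 2) + e n) := by
    intro n
    have ht := raise_add_lower (x := x) (i := i) (t := t) hq hQ (n + 1) (e (n + 1))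
    have hu := heu (n + 1)
    rw [Nat.cast_succ] at hu
    rw [hu, hed, ← smul_add] at ht
    rw [div_eq_inv_mul, mul_smul, ht, inv_smul_smul₀ (by exact_mod_cast hgap (n + 1))]
  have hmem : ∀ k, e k ∈ Submodule.span ℂ (Set.range e) := fun k =>
    Submodule.subset_span ⟨k, rfl⟩
  obtain ⟨b, hb⟩ := hirr.exists_basis (μ := fun n : ℕ => weight q x n) (fun m n => hinj m n)
    hene hei fun n => by
      rcases n with _ | n
      · rw [ht0]
        exact Submodule.smul_mem _ _ (Submodule.sub_mem _ (hmem _)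
          (Submodule.smul_mem _ _ (hmem _)))
      · rw [ht1]
        exact Submodule.smul_mem _ _ (Submodule.add_mem _ (hmem _) (hmem _))
  exact ⟨_, hr, b, fun n => by rw [hb, hei], by rw [hb, hb, ht0],
    fun n => by rw [hb, hb, hb, ht1]⟩

end Classification

/-! ### From operators on the domain to representations -/

section Representation

variable {p : ℂ}

theorem UqIso.lift_gen {A : Type*} [Ring A] [Algebra ℂ A] (i t1 t2 : A)
    (h1 : p • (i * t2) - p⁻¹ • (t2 * i) = t1)
    (h2 : p • (t1 * i) - p⁻¹ • (i * t1) = t2)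
    (h3 : p • (t2 * t1) - p⁻¹ • (t1 * t2) = 0) (x : IsoGen) :
    UqIso.lift p i t1 t2 h1 h2 h3 (UqIso.gen p x) = match x with
      | IsoGen.I => i
      | IsoGen.T1 => t1
      | IsoGen.T2 => t2 := by
  cases x <;> simp [UqIso.lift, UqIso.gen]

theorem UqIso.gen_T1 : UqIso.gen p IsoGen.T1 =
    p • (UqIso.gen p IsoGen.I * UqIso.gen p IsoGen.T2)
      - p⁻¹ • (UqIso.gen p IsoGen.T2 * UqIso.gen p IsoGen.I) := by
  simpa [UqIso.gen] using (RingQuot.mkAlgHom_rel ℂ (IsoRel.rel1 (p := p))).symm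

theorem UqIso.gen_T2 : UqIso.gen p IsoGen.T2 =
    p • (UqIso.gen p IsoGen.T1 * UqIso.gen p IsoGen.I)
      - p⁻¹ • (UqIso.gen p IsoGen.I * UqIso.gen p IsoGen.T1) := by
  simpa [UqIso.gen] using (RingQuot.mkAlgHom_rel ℂ (IsoRel.rel2 (p := p))).symm

theorem UqIso.gen_T2_T1 : p • (UqIso.gen p IsoGen.T2 * UqIso.gen p IsoGen.T1)
      - p⁻¹ • (UqIso.gen p IsoGen.T1 * UqIso.gen p IsoGen.T2) = 0 := by
  simpa [UqIso.gen] using RingQuot.mkAlgHom_rel ℂ (IsoRel.rel3 (p := p))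

/-- `I` and `T₂` generate `U_q(iso₂)`. -/
theorem UqIso.adjoin_eq_top :
    Algebra.adjoin ℂ {UqIso.gen p IsoGen.I, UqIso.gen p IsoGen.T2} = ⊤ := by
  have hI : UqIso.gen p IsoGen.I ∈
      Algebra.adjoin ℂ {UqIso.gen p IsoGen.I, UqIso.gen p IsoGen.T2} :=
    Algebra.subset_adjoin (by simp)
  have h2 : UqIso.gen p IsoGen.T2 ∈
      Algebra.adjoin ℂ {UqIso.gen p IsoGen.I, UqIso.gen p IsoGen.T2} :=
    Algebra.subset_adjoin (by simp)
  have hgen : ∀ x, UqIso.gen p x ∈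
      Algebra.adjoin ℂ {UqIso.gen p IsoGen.I, UqIso.gen p IsoGen.T2} := by
    rintro (_ | _ | _)
    · exact hI
    · rw [UqIso.gen_T1]
      exact sub_mem (Subalgebra.smul_mem _ (mul_mem hI h2) _)
        (Subalgebra.smul_mem _ (mul_mem h2 hI) _)
    · exact h2
  rw [eq_top_iff]
  rintro a -
  obtain ⟨a, rfl⟩ := RingQuot.mkAlgHom_surjective ℂ (IsoRel p) a
  induction a using FreeAlgebra.induction with
  | grade0 r => rw [AlgHom.commutes]; exact Subalgebra.algebraMap_mem _ r
  | grade1 x => exact hgen x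
  | mul a b ha hb => rw [map_mul]; exact mul_mem ha hb
  | add a b ha hb => rw [map_add]; exact add_mem ha hb

variable {H : Type*} [NormedAddCommGroup H] [InnerProductSpace ℂ H]

set_option linter.unnecessarySeqFocus false in
theorem isCubicPair_of_hom (hp : p ≠ 0) {D : Type*} [AddCommGroup D] [Module ℂ D]
    (φ : UqIso p →ₐ[ℂ] Module.End ℂ D) :
    IsCubicPair (p ^ 2) (φ (UqIso.gen p IsoGen.I)) (φ (UqIso.gen p IsoGen.T2)) := by
  have h1 := congrArg φ (UqIso.gen_T1 (p := p))
  have h2 := congrArg φ (UqIso.gen_T2 (p := p))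
  have h3 := congrArg φ (UqIso.gen_T2_T1 (p := p))
  simp only [map_sub, map_smul, map_mul, map_zero] at h1 h2 h3
  rw [h1] at h2 h3
  refine ⟨fun v => ?_, fun v => ?_⟩
  · have h := LinearMap.congr_fun h2 v
    simp only [LinearMap.sub_apply, LinearMap.smul_apply, Module.End.mul_apply, map_sub,
      map_smul] at h
    rw [← sub_eq_zero] at h ⊢
    rw [← h]
    match_scalars <;> field_simp <;> ring
  · have h := LinearMap.congr_fun h3 v
    simp only [LinearMap.sub_apply, LinearMap.smul_apply, Module.End.mul_apply, map_sub,
      map_smul, LinearMap.zero_apply] at h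
    rw [← sub_eq_zero, ← neg_eq_zero, ← h]
    match_scalars <;> field_simp <;> ring

theorem OperatorRep.IsIrreducible.isIrreduciblePair {π : OperatorRep p H}
    (hirr : π.IsIrreducible) :
    IsIrreduciblePair (π.hom (UqIso.gen p IsoGen.I)) (π.hom (UqIso.gen p IsoGen.T2)) := by
  intro V hI h2
  refine hirr.eq_bot_or_eq_top V fun a => ?_
  have ha : a ∈ Algebra.adjoin ℂ {UqIso.gen p IsoGen.I, UqIso.gen p IsoGen.T2} := by
    rw [UqIso.adjoin_eq_top]
    trivial
  induction ha using Algebra.adjoin_induction with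
  | mem x hx => rcases hx with rfl | rfl <;> assumption
  | algebraMap r =>
    intro v hv
    rw [AlgHom.commutes]
    exact V.smul_mem r hv
  | add a b _ _ ha hb =>
    intro v hv
    rw [map_add]
    exact V.add_mem (ha v hv) (hb v hv)
  | mul a b _ _ ha hb =>
    intro v hv
    rw [map_mul]
    exact ha _ (hb v hv)

/-- A one-dimensional domain is closed, hence all of `H`. -/
theorem OperatorRep.finrank_eq_one (π : OperatorRep p H) (h : Module.finrank ℂ π.domain = 1) :
    Module.finrank ℂ H = 1 := by
  have : FiniteDimensional ℂ π.domain := Module.finite_of_finrank_eq_succ h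
  have htop : π.domain = ⊤ := by
    have h1 := Submodule.dense_iff_topologicalClosure_eq_top.1 π.dense_domain
    rwa [(Submodule.closed_of_finiteDimensional π.domain).submodule_topologicalClosure_eq] at h1
  rw [← finrank_top ℂ H, ← htop, h]

theorem OperatorRep.exists_eigenvector {π : OperatorRep p H} (hdiag : π.IsDiagonalizable)
    (hirr : π.IsIrreducible) :
    ∃ (μ : ℂ) (v : π.domain), v ≠ 0 ∧ π.hom (UqIso.gen p IsoGen.I) v = μ • v := by
  by_contra! hcon
  have := hirr.nontrivial
  obtain ⟨u, hu⟩ := exists_ne (0 : π.domain)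
  have hd := hdiag.dense_span_eigenvectors
  rw [Submodule.span_eq_bot.2, Submodule.bot_coe, dense_iff_closure_eq, closure_singleton] at hd
  · refine hu (Subtype.ext ?_)
    have : (u : H) ∈ ({0} : Set H) := by rw [hd]; trivial
    simpa using this
  · rintro _ ⟨μ, v, hv, rfl⟩
    by_contra hv0
    exact hcon μ v (fun h => hv0 (by simp [h])) hv

/-- A representation is equivalent to one given in coordinates as soon as its domain has a basis
on which `I` and `T₂` act by the prescribed formulas. -/
theorem OperatorRep.isEquivalent_ofCoordinates (π : OperatorRep p H) {ι : Type*}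
    (φ : UqIso p →ₐ[ℂ] Module.End ℂ (ι →₀ ℂ)) (b : Module.Basis ι ℂ π.domain)
    (hI : ∀ k, π.hom (UqIso.gen p IsoGen.I) (b k) =
      b.repr.symm (φ (UqIso.gen p IsoGen.I) (Finsupp.single k 1)))
    (hT : ∀ k, π.hom (UqIso.gen p IsoGen.T2) (b k) =
      b.repr.symm (φ (UqIso.gen p IsoGen.T2) (Finsupp.single k 1))) :
    π.IsEquivalent (OperatorRep.ofCoordinates φ) := by
  have key : ∀ a v, b.repr (π.hom a v) = φ a (b.repr v) := by
    intro a
    have ha : a ∈ Algebra.adjoin ℂ {UqIso.gen p IsoGen.I, UqIso.gen p IsoGen.T2} := by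
      rw [UqIso.adjoin_eq_top]
      trivial
    induction ha using Algebra.adjoin_induction with
    | mem x hx =>
      have hx' : ∀ k, π.hom x (b k) = b.repr.symm (φ x (Finsupp.single k 1)) := by
        rcases hx with rfl | rfl <;> assumption
      refine LinearMap.congr_fun (f := b.repr.toLinearMap ∘ₗ π.hom x)
        (g := φ x ∘ₗ b.repr.toLinearMap) (b.ext fun k => ?_)
      simp [hx']
    | algebraMap r => intro v; simp [Algebra.algebraMap_eq_smul_one]
    | add a b _ _ ha hb => intro v; simp [ha, hb]
    | mul a b _ _ ha hb => intro v; simp [ha, hb]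
  let c := (l2Basis ι).orthonormal.linearIndependent.linearCombinationEquiv
  refine ⟨⊤, ⊤, fun _ _ _ => trivial, fun _ _ _ => trivial, ?_, ?_,
    LinearEquiv.ofTop ⊤ rfl ≪≫ₗ (b.repr ≪≫ₗ c) ≪≫ₗ (LinearEquiv.ofTop ⊤ rfl).symm, ?_⟩
  · rw [Submodule.map_top, Submodule.range_subtype]
    exact π.dense_domain
  · rw [Submodule.map_top, Submodule.range_subtype]
    exact (OperatorRep.ofCoordinates φ).dense_domain
  · intro a v
    apply Subtype.ext
    change c (b.repr (π.hom a v)) = c (φ a (c.symm (c (b.repr v))))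
    rw [key, LinearEquiv.symm_apply_apply]

end Representation

/-! ### The classification -/

theorem theorem2 (p : ℂ) (hp : p ≠ 0) (hq : ∀ n : ℕ, 0 < n → (p ^ 2) ^ n ≠ 1)
    {H : Type*} [NormedAddCommGroup H] [InnerProductSpace ℂ H] [CompleteSpace H]
    (π : OperatorRep p H) (hdiag : π.IsDiagonalizable) (hfin : π.HasFiniteMultiplicities)
    (hirr : π.IsIrreducible) :
    Module.finrank ℂ H = 1 ∨
    (∃ (r s : ℂ) (_ : r ≠ 0) (hs : s ≠ 0)
      (hs' : ∀ n : ℤ, s ≠ Complex.I * (p ^ 2) ^ n ∧ s ≠ -(Complex.I * (p ^ 2) ^ n))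
      (_ : ∀ n : ℤ, s ≠ Complex.I * p ^ (2 * n + 1) ∧ s ≠ -(Complex.I * p ^ (2 * n + 1))),
      π.IsEquivalent (classicalRep p r s hp hq hs hs')) ∨
    (∃ (r : ℂ) (_ : r ≠ 0) (ε ε' : ℤˣ),
      π.IsEquivalent (nonclassicalRep p r ε ε' hp hq)) := by
  have hq0 : p ^ 2 ≠ 0 := pow_ne_zero 2 hp
  have hQ := q_sub_inv_ne hp hq
  have hI := Complex.I_sq
  have hpair := isCubicPair_of_hom hp π.hom
  have hirr' := hirr.isIrreduciblePair
  obtain ⟨μ, v, hv, hiv⟩ := OperatorRep.exists_eigenvector hdiag hirr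
  obtain ⟨x, hx, rfl⟩ := exists_weight_eq hQ μ
  by_cases hgen : ∀ m : ℤ, x ^ 2 ≠ -(p ^ 2) ^ m
  · have : FiniteDimensional ℂ
      ((π.hom (UqIso.gen p IsoGen.I)).eigenspace (weight (p ^ 2) x 0)) := hfin _
    rcases hpair.classical_alternative hirr' hq0 hq hQ hx hgen hv hiv with
      h1 | ⟨r, hr, b, hbI, hbT⟩
    · exact Or.inl (π.finrank_eq_one h1)
    have hne : ∀ a : ℂ, ∀ m : ℤ, a ^ 2 = (p ^ 2) ^ m →
        x ≠ Complex.I * a ∧ x ≠ -(Complex.I * a) := fun a m ha =>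
      ⟨fun h => hgen m (by rw [h, mul_pow, hI, ha, neg_one_mul]),
        fun h => hgen m (by rw [h, neg_sq, mul_pow, hI, ha, neg_one_mul])⟩
    refine Or.inr (Or.inl ⟨r, x, hr, hx,
      fun n => hne _ (n * 2) (by rw [zpow_mul]; rfl),
      fun n => hne _ (2 * n + 1) (by rw [← zpow_natCast, ← zpow_mul, ← zpow_natCast, ← zpow_mul,
        mul_comm]),
      π.isEquivalent_ofCoordinates _ b (fun n => ?_) fun n => ?_⟩)
    · rw [hbI, UqIso.lift_gen]
      simp [classicalI, opOfBasis_single, weight]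
    · rw [hbT, UqIso.lift_gen]
      simp [classicalT2, opOfBasis_single, weightGap]
  push Not at hgen
  obtain ⟨m, hm⟩ := hgen
  obtain ⟨y, n, hy | hy, hn⟩ := exists_folded_ladder hq0 hm
  · exact Or.inl (π.finrank_eq_one (hpair.finrank_eq_one_of_sq_eq_neg_one hirr' hq0 hq hQ hy
      hdiag.no_jordan_block ⟨n, v, hv, by rw [hn, hiv]⟩))
  have : FiniteDimensional ℂ
      ((π.hom (UqIso.gen p IsoGen.I)).eigenspace (weight (p ^ 2) y 0)) := hfin _
  rcases hpair.nonclassical_alternative hirr' hq0 hq hQ hy ⟨n, v, hv, by rw [hn, hiv]⟩ with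
    h1 | ⟨r, hr, b, hbI, hbT0, hbT⟩
  · exact Or.inl (π.finrank_eq_one h1)
  obtain ⟨ε, hε⟩ : ∃ ε : ℤˣ, y = ((ε : ℤ) : ℂ) * Complex.I * p := by
    have : y ^ 2 = (Complex.I * p) ^ 2 := by rw [hy, mul_pow, hI, neg_one_mul]
    rcases sq_eq_sq_iff_eq_or_eq_neg.1 this with h | h
    · exact ⟨1, by simp [h]⟩
    · exact ⟨-1, by simp [h]⟩
  have hε2 : ((ε : ℤ) : ℂ) ^ 2 = 1 := by rcases Int.units_eq_one_or ε with h | h <;> simp [h]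
  have hεinv : ((ε : ℤ) : ℂ)⁻¹ = ((ε : ℤ) : ℂ) := by
    rcases Int.units_eq_one_or ε with h | h <;> norm_num [h]
  have hyn : ∀ n : ℕ, y * (p ^ 2) ^ (n : ℤ) = ((ε : ℤ) : ℂ) * Complex.I * p ^ (2 * n + 1) :=
    fun n => by
      rw [hε, zpow_natCast]
      ring
  have hyn' : ∀ n : ℕ, y⁻¹ * (p ^ 2) ^ (-(n : ℤ)) =
      -(((ε : ℤ) : ℂ) * Complex.I * (p ^ (2 * n + 1))⁻¹) := fun n => by
    rw [zpow_neg, ← mul_inv, hyn, mul_inv, mul_inv, hεinv, Complex.inv_I]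
    ring
  have hw : ∀ n : ℕ, weight (p ^ 2) y n =
      -((ε : ℤ) : ℂ) * (p ^ (2 * n + 1) + (p ^ (2 * n + 1))⁻¹) / (p ^ 2 - (p ^ 2)⁻¹) := by
    intro n
    rw [weight, hyn, hyn']
    congr 1
    linear_combination ((ε : ℤ) : ℂ) * (p ^ (2 * n + 1) + (p ^ (2 * n + 1))⁻¹) * hI
  have hg : ∀ n : ℕ, r / weightGap (p ^ 2) y n =
      -((ε : ℤ) : ℂ) * Complex.I * r / (p ^ (2 * n + 1) - (p ^ (2 * n + 1))⁻¹) := by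
    intro n
    rw [weightGap, hyn, hyn', ← sub_eq_add_neg, ← mul_sub, div_mul_eq_div_div,
      div_eq_mul_inv r, mul_inv, hεinv, Complex.inv_I]
    ring
  refine Or.inr (Or.inr ⟨r, hr, ε, 1,
    π.isEquivalent_ofCoordinates _ b (fun n => ?_) fun n => ?_⟩)
  · rw [hbI, UqIso.lift_gen, hw]
    simp [nonclassicalI, opOfBasis_single]
  · rw [UqIso.lift_gen]
    rcases n with _ | n
    · have h0 := hg 0
      simp only [Nat.cast_zero, mul_zero, zero_add, pow_one] at h0
      rw [hbT0, h0]
      simp only [nonclassicalT2, opOfBasis_single, one_smul, map_smul, map_add,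
        Module.Basis.repr_symm_single, Units.val_one, Int.cast_one]
      match_scalars
      · ring
      · linear_combination
          ((ε : ℤ) : ℂ) * r / (p - p⁻¹) * hI
    · have h1 := hg (n + 1)
      rw [Nat.cast_succ] at h1
      rw [hbT, h1]
      simp [nonclassicalT2, opOfBasis_single]
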